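/- Let $D=\frac{d}{dx}$ and let $\theta=DxD$ be the Laguerre derivative. For $\beta>0$ and a function $f$ on $(0,\infty)$ the Laguerre fractional integrals are $$(L_{0+}^{\beta}f)(x)=\frac1{\Gamma(2\beta)}\int_0^x (x-u)^{2\beta-1}u^{-\beta}\,{}_2F_1\!\left(\beta,\beta;2\beta;1-\frac xu\right)f(u)\,du,$$ $$(L_{-}^{\beta}f)(x)=\frac{x^{-\beta}}{\Gamma(2\beta)}\int_x^\infty (u-x)^{2\beta-1}\,{}_2F_1\!\left(\beta,\beta;2\beta;1-\frac ux\right)f(u)\,du\qquad(x>0),$$ where ${}_2F_1$ is the Gauss hypergeometric function (analytically continued to the negative half-axis). For $\alpha>0$ and $m=[\alpha]+1$ the Laguerre fractional derivatives are $\mathcal D_{0+}^{\alpha}f=\theta^m L_{0+}^{m-\alpha}f$ and $\mathcal D_{-}^{\alpha}f=\theta^m L_{-}^{m-\alpha}f$. For $c\in\mathbb R$, $L_{c,1}(\mathbb R_+)$ is the space of measurable functions $f:(0,\infty)\to\mathbb C$ with $\int_0^\infty|f(x)|x^{c-1}dx<\infty$, and $f^*(s)=\int_0^\infty f(x)x^{s-1}dx$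 is the Mellin transform. **Theorem.** Let $\alpha>0$, $m=[\alpha]+1$, $\nu<1+\alpha-m$, $f\in L_{1-\nu-m,1}(\mathbb R_+)$, $g\in L_{\nu+m-\alpha,1}(\mathbb R_+)$, and suppose that $s^{2\alpha}g^*(s-\alpha)$ is integrable on the vertical line $\operatorname{Re}s=\nu+m$ and that $s^{2\alpha}f^*(s-\alpha)$ is integrable on the vertical line $\operatorname{Re}s=1+\alpha-\nu-m$. If $\nu\ge 1+\alpha-2m$, suppose also that the integral defining $(L_-^{m-\alpha}f)(x)$ converges absolutely for every $x>0$ (for $\nu<1+\alpha-2m$ this is automatic and is part of the conclusion). Then the integrals defining $(L_{0+}^{m-\alpha}g)(x)$ and $(L_-^{m-\alpha}f)(x)$ converge absolutely for every $x>0$, both functions are $2m$ times continuously differentiable on $(0,\infty)$ (so that $\mathcal D_{0+}^\alpha g$ and $\mathcal D_-^\alpha f$ are defined pointwise), and $$\int_0^\infty f(x)\,(\mathcal D_{0+}^{\alpha}g)(x)\,dx=\int_0^\infty g(x)\,(\mathcal D_{-}^{\alpha}f)(x)\,dx,$$ where both integrals converge absolutely. -/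

import Mathlib

open MeasureTheory Set Complex

/-- The weighted space `L_{c,1}(ℝ₊)`: (measurable) functions on the positive half-axis with
`∫₀^∞ |f(x)| x^{c-1} dx < ∞`. -/
def MemWeightedL1 (c : ℝ) (f : ℝ → ℂ) : Prop :=
  IntegrableOn (fun x : ℝ => ((x ^ (c - 1) : ℝ) : ℂ) * f x) (Ioi 0)

/-- The Gauss hypergeometric function `₂F₁(a, b; c; z)` for real parameters with `c > b > 0` and
real argument `z < 1`, given by Euler's integral. (The power series only converges for `|z| < 1`,
while arguments in the whole ray `(-∞, 0)` are needed; Euler's integral is the analytic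
continuation.) -/
noncomputable def gaussHypergeometric (a b c z : ℝ) : ℝ :=
  Real.Gamma c / (Real.Gamma b * Real.Gamma (c - b)) *
    ∫ t in Ioo (0 : ℝ) 1, t ^ (b - 1) * (1 - t) ^ (c - b - 1) * (1 - z * t) ^ (-a)

/-- The integrand (as a function of `u ∈ (0, x)`) of the left-sided Laguerre fractional integral
of order `β` of `f` at the point `x`. -/
noncomputable def laguerreLeftIntegrand (β : ℝ) (f : ℝ → ℂ) (x u : ℝ) : ℂ :=
  (((x - u) ^ (2 * β - 1) * u ^ (-β) *
    gaussHypergeometric β β (2 * β) (1 - x / u) : ℝ) : ℂ) * f u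

/-- The integrand (as a function of `u ∈ (x, ∞)`) of the right-sided Laguerre fractional integral
of order `β` of `f` at the point `x`. -/
noncomputable def laguerreRightIntegrand (β : ℝ) (f : ℝ → ℂ) (x u : ℝ) : ℂ :=
  (((u - x) ^ (2 * β - 1) *
    gaussHypergeometric β β (2 * β) (1 - u / x) : ℝ) : ℂ) * f u

/-- The left-sided Laguerre fractional integral `L_{0+}^β f`. -/
noncomputable def laguerreIntegralLeft (β : ℝ) (f : ℝ → ℂ) (x : ℝ) : ℂ :=
  ((1 / Real.Gamma (2 * β) : ℝ) : ℂ) * ∫ u in Ioo 0 x, laguerreLeftIntegrand β f x u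

/-- The right-sided Laguerre fractional integral `L_-^β f`. -/
noncomputable def laguerreIntegralRight (β : ℝ) (f : ℝ → ℂ) (x : ℝ) : ℂ :=
  ((x ^ (-β) / Real.Gamma (2 * β) : ℝ) : ℂ) * ∫ u in Ioi x, laguerreRightIntegrand β f x u

/-- The integral defining `L_{0+}^β f` converges (absolutely) at every point `x > 0`. -/
def LaguerreIntegralLeftConverges (β : ℝ) (f : ℝ → ℂ) : Prop :=
  ∀ x : ℝ, 0 < x → IntegrableOn (laguerreLeftIntegrand β f x) (Ioo 0 x)

/-- The integral defining `L_-^β f` converges (absolutely) at every point `x > 0`. -/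
def LaguerreIntegralRightConverges (β : ℝ) (f : ℝ → ℂ) : Prop :=
  ∀ x : ℝ, 0 < x → IntegrableOn (laguerreRightIntegrand β f x) (Ioi x)

/-- The Laguerre derivative `θ = D x D`, `D = d/dx`. -/
noncomputable def laguerreTheta (h : ℝ → ℂ) : ℝ → ℂ :=
  deriv fun x : ℝ => (x : ℂ) * deriv h x

/-- The order `m = [α] + 1` of the integer Laguerre derivative. -/
noncomputable def laguerreOrder (α : ℝ) : ℕ := ⌊α⌋₊ + 1

/-- The left-sided Laguerre fractional derivative
`𝒟_{0+}^α f = θ^m (L_{0+}^{m-α} f)`, `m = [α] + 1`. -/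
noncomputable def laguerreDerivLeft (α : ℝ) (f : ℝ → ℂ) : ℝ → ℂ :=
  laguerreTheta^[laguerreOrder α] (laguerreIntegralLeft (laguerreOrder α - α) f)

/-- The right-sided Laguerre fractional derivative
`𝒟_-^α f = θ^m (L_-^{m-α} f)`, `m = [α] + 1`. -/
noncomputable def laguerreDerivRight (α : ℝ) (f : ℝ → ℂ) : ℝ → ℂ :=
  laguerreTheta^[laguerreOrder α] (laguerreIntegralRight (laguerreOrder α - α) f)

/-! In the coordinate `t = log x` everything becomes convolution and Fourier analysis. Euler's
integral for the hypergeometric factor is a disguised convolution: `L_{0+}^β` is multiplication by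
`e^{βt}` after convolution with `logKernel`, the convolution square of `halfKernel`. Equivalently,
`L_{0+}^β = I^β x^{-β} I^β` with the Riemann--Liouville integral `I^β`. On a line `Re s = c < 1` it
therefore multiplies the Mellin transform by `symbol ^ 2`, where `symbol β z` is `Γ(1-z)/Γ(1-z+β)`,
and moves the line by `-β`. Only two properties of `symbol` matter, and both are proved from its
integral: the decay `O((1+|τ|)^{-β})` (`symbol_vertical_bound`) and `symbol_functional_equation`.

Each `θ` multiplies `x^{-s}` by `s²` and moves the line by `1`. With `β = m - α`, the operator `θ^m
L_{0+}^β` is thus a multiplier of size `(1+|τ|)^{2m-2β} = (1+|τ|)^{2α}`, which is what the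
hypotheses on `s^{2α} g^*(s-α)` and `s^{2α} f^*(s-α)` absorb. Hence `𝒟_{0+}^α g` is an absolutely
convergent inverse Mellin integral, and Parseval's identity turns `∫ f 𝒟_{0+}^α g` into an
expression symmetric in the two sides (`integral_laguerreMultiplier_adjoint`), once `𝒟_-^α f` is
known to be the inverse Mellin integral with the reflected multiplier.

That last point is the difficulty. If `L_-^β f` is merely assumed to converge, the line of `f` may
lie outside the strip where the transform of the right-sided kernel exists, so the Mellin calculus
does not apply to it. Duality is used instead: against test functions `θ^m` is moved to the test
function, `L_-^β` is exchanged for `L_{0+}^β` by Fubini, and `L_{0+}^β θ^m ψ = θ^m L_{0+}^β ψ`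
follows from the functional equation (`logLeft_logTheta_iterate`). This gives `θ^m L_-^β f = h`
weakly, with `h` continuous; a regularity theorem for `θ^m` (`contDiff_of_weak_logTheta`) makes it
classical. -/

open scoped ContDiff FourierTransform

/-! ### The half kernel and the decay of its transform on vertical lines -/

/-- The function `r ↦ e^{-r} (1 - e^{-r})^{β-1} / Γ(β)` on the positive half-axis, extended by zero:
in the coordinate `log x` the operator `x^{-β} I_{0+}^β` (Riemann--Liouville) is convolution with
it. -/
noncomputable def halfKernel (β r : ℝ) : ℝ :=
  if 0 < r then Real.exp (-r) * (1 - Real.exp (-r)) ^ (β - 1) / Real.Gamma β else 0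

/-- The convolution kernel of the Laguerre fractional integral in the coordinate `log x`. -/
noncomputable def logKernel (β r : ℝ) : ℝ := ∫ y, halfKernel β y * halfKernel β (r - y)

/-- The two-sided Laplace transform of `halfKernel`. -/
noncomputable def symbol (β : ℝ) (z : ℂ) : ℂ := ∫ r : ℝ, (halfKernel β r : ℂ) * cexp (z * r)

lemma one_sub_exp_neg_pos {r : ℝ} (hr : 0 < r) : 0 < 1 - Real.exp (-r) := by
  rw [sub_pos, Real.exp_lt_one_iff]
  linarith

lemma halfKernel_of_pos {r : ℝ} (β : ℝ) (hr : 0 < r) : halfKernel β r =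
    Real.exp (-r) * (1 - Real.exp (-r)) ^ (β - 1) / Real.Gamma β := if_pos hr

lemma halfKernel_of_nonpos {r : ℝ} (β : ℝ) (hr : r ≤ 0) : halfKernel β r = 0 :=
  if_neg (not_lt.2 hr)

lemma halfKernel_nonneg {β : ℝ} (hβ : 0 < β) (r : ℝ) : 0 ≤ halfKernel β r := by
  rcases lt_or_ge 0 r with hr | hr
  · rw [halfKernel_of_pos β hr]
    have := one_sub_exp_neg_pos hr
    have := Real.Gamma_pos_of_pos hβ
    positivity
  · rw [halfKernel_of_nonpos β hr]

lemma measurable_halfKernel (β : ℝ) : Measurable (halfKernel β) := by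
  unfold halfKernel
  refine Measurable.ite measurableSet_Ioi ?_ measurable_const
  fun_prop

lemma continuousAt_halfKernel (β : ℝ) {r : ℝ} (hr : r ≠ 0) : ContinuousAt (halfKernel β) r := by
  rcases lt_or_gt_of_ne hr with h | h
  · refine (continuousAt_const (y := (0 : ℝ))).congr ?_
    filter_upwards [Iio_mem_nhds h] with y hy
    exact (halfKernel_of_nonpos β (le_of_lt hy)).symm
  · have : ContinuousAt (fun r => Real.exp (-r) * (1 - Real.exp (-r)) ^ (β - 1) / Real.Gamma β) r := by
      refine ContinuousAt.div_const (ContinuousAt.mul (by fun_prop) ?_) _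
      exact ContinuousAt.rpow_const (by fun_prop) (Or.inl (one_sub_exp_neg_pos h).ne')
    refine this.congr ?_
    filter_upwards [Ioi_mem_nhds h] with y hy
    exact (halfKernel_of_pos β hy).symm

lemma one_sub_exp_neg_rpow_antitone {β : ℝ} (hβ : β ≤ 1) {a b : ℝ} (ha : 0 < a) (hab : a ≤ b) :
    (1 - Real.exp (-b)) ^ (β - 1) ≤ (1 - Real.exp (-a)) ^ (β - 1) := by
  refine Real.rpow_le_rpow_of_nonpos (one_sub_exp_neg_pos ha) ?_ (by linarith)
  have := Real.exp_le_exp.2 (neg_le_neg hab)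
  linarith

lemma halfKernel_antitoneOn {β : ℝ} (hβ : 0 < β) (hβ1 : β ≤ 1) :
    AntitoneOn (halfKernel β) (Ioi 0) := by
  intro a ha b hb hab
  have ha : 0 < a := ha
  have hb : 0 < b := hb
  rw [halfKernel_of_pos β ha, halfKernel_of_pos β hb]
  have h1 := one_sub_exp_neg_rpow_antitone hβ1 ha hab
  have h2 := Real.Gamma_pos_of_pos hβ
  have := one_sub_exp_neg_pos hb
  gcongr

/-- Comes from `1 - e^{-r} ≥ r / (1 + r)`. One bound covers the singularity at `0` and the behaviour
at infinity, since the factor `1 + r` is harmless against exponential decay. -/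
lemma one_sub_exp_neg_rpow_le {β : ℝ} (hβ : 0 < β) (hβ1 : β ≤ 1) {r : ℝ} (hr : 0 < r) :
    (1 - Real.exp (-r)) ^ (β - 1) ≤ (1 + r) * r ^ (β - 1) := by
  have h1 : r / (1 + r) ≤ 1 - Real.exp (-r) := by
    have h2 : 1 + r ≤ Real.exp r := by linarith [Real.add_one_le_exp r]
    have h3 : Real.exp (-r) ≤ (1 + r)⁻¹ := by
      rw [Real.exp_neg]
      gcongr
    have : r / (1 + r) = 1 - (1 + r)⁻¹ := by field_simp; ring
    linarith
  calc (1 - Real.exp (-r)) ^ (β - 1) ≤ (r / (1 + r)) ^ (β - 1) :=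
        Real.rpow_le_rpow_of_nonpos (by positivity) h1 (by linarith)
    _ = (1 + r) ^ (1 - β) * r ^ (β - 1) := by
        rw [Real.div_rpow hr.le (by positivity), div_eq_mul_inv, ← Real.rpow_neg (by positivity),
          mul_comm]
        ring_nf
    _ ≤ (1 + r) * r ^ (β - 1) := by
        gcongr
        calc (1 + r) ^ (1 - β) ≤ (1 + r) ^ (1 : ℝ) :=
              Real.rpow_le_rpow_of_exponent_le (by linarith) (by linarith)
          _ = 1 + r := Real.rpow_one _

lemma halfKernel_le {β : ℝ} (hβ : 0 < β) (hβ1 : β ≤ 1) {r : ℝ} (hr : 0 < r) :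
    halfKernel β r ≤ Real.exp (-r) * ((1 + r) * r ^ (β - 1)) / Real.Gamma β := by
  rw [halfKernel_of_pos β hr]
  have h1 := one_sub_exp_neg_rpow_le hβ hβ1 hr
  have h2 := Real.Gamma_pos_of_pos hβ
  gcongr

lemma integrable_halfKernel_mul_exp {β : ℝ} (hβ : 0 < β) (hβ1 : β ≤ 1) {c : ℝ} (hc : c < 1) :
    Integrable fun r => halfKernel β r * Real.exp (c * r) := by
  have hG := Real.Gamma_pos_of_pos hβ
  have h1 := integrableOn_rpow_mul_exp_neg_mul_rpow (p := 1) (s := β - 1) (b := 1 - c)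
    (by linarith) one_pos (by linarith)
  have h2 := integrableOn_rpow_mul_exp_neg_mul_rpow (p := 1) (s := β) (b := 1 - c)
    (by linarith) one_pos (by linarith)
  have h3 := ((h1.add h2).div_const (Real.Gamma β))
  have h4 : IntegrableOn (fun r => halfKernel β r * Real.exp (c * r)) (Ioi 0) := by
    refine Integrable.mono' h3 ?_ ?_
    · exact ((measurable_halfKernel β).mul (by fun_prop)).aestronglyMeasurable
    · refine (ae_restrict_iff' measurableSet_Ioi).2 (Filter.Eventually.of_forall fun r hr => ?_)
      have hr : 0 < r := hr
      rw [Real.norm_of_nonneg (mul_nonneg (halfKernel_nonneg hβ r) (Real.exp_pos _).le)]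
      calc halfKernel β r * Real.exp (c * r)
          ≤ Real.exp (-r) * ((1 + r) * r ^ (β - 1)) / Real.Gamma β * Real.exp (c * r) := by
            gcongr
            exact halfKernel_le hβ hβ1 hr
        _ = _ := by
            have e1 : r ^ β = r * r ^ (β - 1) := by
              rw [Real.rpow_sub_one hr.ne']; field_simp
            have e2 : Real.exp (-(1 - c) * r ^ (1 : ℝ)) = Real.exp (-r) * Real.exp (c * r) := by
              rw [Real.rpow_one, ← Real.exp_add]; ring_nf
            simp only [Pi.add_apply, e1, e2]
            ring
  refine (integrableOn_iff_integrable_of_support_subset ?_).1 h4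
  intro r hr
  by_contra h
  exact hr (by simp [halfKernel_of_nonpos β (not_lt.1 h)])

lemma integrable_halfKernel_mul_cexp {β : ℝ} (hβ : 0 < β) (hβ1 : β ≤ 1) {z : ℂ} (hz : z.re < 1) :
    Integrable fun r : ℝ => (halfKernel β r : ℂ) * cexp (z * r) := by
  refine Integrable.mono' (integrable_halfKernel_mul_exp hβ hβ1 hz) ?_ ?_
  · exact ((measurable_halfKernel β).complex_ofReal.mul (by fun_prop)).aestronglyMeasurable
  · refine Filter.Eventually.of_forall fun r => ?_
    rw [norm_mul, norm_real, Real.norm_of_nonneg (halfKernel_nonneg hβ r), Complex.norm_exp]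
    simp

/-- An integrable nonnegative function that is zero on `(-∞, 0]` and decreasing on `(0, ∞)` has
Fourier transform at most its integral over half a period. -/
lemma norm_integral_antitone_mul_cexp_le {a : ℝ → ℝ} (ha0 : ∀ r, 0 ≤ a r)
    (ha : AntitoneOn a (Ioi 0)) (haz : ∀ r ≤ 0, a r = 0) (hai : Integrable a) {τ : ℝ} (hτ : τ ≠ 0) :
    ‖∫ r : ℝ, (a r : ℂ) * cexp (τ * I * r)‖ ≤ ∫ r in Ioc 0 (Real.pi / |τ|), a r := by
  -- Translation by half a period flips the sign of the exponential, so twice the transform of `a`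
  -- is the transform of `a r - a (r - δ)`.
  set δ : ℝ := Real.pi / |τ| with hδ
  have hδ0 : 0 < δ := div_pos Real.pi_pos (abs_pos.2 hτ)
  have hexp : ∀ r : ℝ, cexp (τ * I * (r - δ : ℝ)) = -cexp (τ * I * r) := by
    intro r
    have : τ * δ = Real.pi ∨ τ * δ = -Real.pi := by
      rcases abs_cases τ with ⟨h, _⟩ | ⟨h, _⟩
      · left; rw [hδ, h]; field_simp
      · right; rw [hδ, h]; field_simp
    have h2 : cexp (τ * δ * I) = -1 := by
      rcases this with h | h
      · rw [← ofReal_mul, h, exp_pi_mul_I]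
      · rw [← ofReal_mul, h, ofReal_neg, neg_mul, Complex.exp_neg, exp_pi_mul_I]; norm_num
    rw [show (τ : ℂ) * I * (r - δ : ℝ) = τ * I * r - τ * δ * I by push_cast; ring,
      Complex.exp_sub, h2]
    rw [div_neg, div_one]
  have hnorm : ∀ r : ℝ, ‖cexp (τ * I * r)‖ = 1 := by
    intro r
    rw [show (τ : ℂ) * I * r = (τ * r : ℝ) * I by push_cast; ring, norm_exp_ofReal_mul_I]
  have hi : ∀ b : ℝ → ℝ, Integrable b → Integrable fun r : ℝ => (b r : ℂ) * cexp (τ * I * r) := by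
    intro b hb
    refine hb.ofReal.mul_bdd (c := 1) (by fun_prop) (Filter.Eventually.of_forall fun r => ?_)
    exact (hnorm r).le
  have hshift : ∫ r : ℝ, (a r : ℂ) * cexp (τ * I * r)
      = -∫ r : ℝ, (a (r - δ) : ℂ) * cexp (τ * I * r) := by
    rw [← integral_sub_right_eq_self _ δ, ← integral_neg]
    refine integral_congr_ae (Filter.Eventually.of_forall fun r => ?_)
    beta_reduce
    rw [hexp]
    ring
  have htwo : 2 * ∫ r : ℝ, (a r : ℂ) * cexp (τ * I * r)
      = ∫ r : ℝ, ((a r - a (r - δ) : ℝ) : ℂ) * cexp (τ * I * r) := by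
    have : ∀ r : ℝ, ((a r - a (r - δ) : ℝ) : ℂ) * cexp (τ * I * r)
      = (a r : ℂ) * cexp (τ * I * r) - (a (r - δ) : ℂ) * cexp (τ * I * r) := by
      intro r; push_cast; ring
    simp only [this]
    rw [integral_sub (hi a hai) (hi _ (hai.comp_sub_right δ)), two_mul]
    nth_rewrite 2 [hshift]
    ring
  -- Beyond `δ` monotonicity fixes the sign of the difference, and on `(0, δ]` only `a r` is
  -- present. The term `a (r - δ) - a r` has integral zero, which leaves twice the integral over
  -- `(0, δ]`.
  have habs : ∀ r, |a r - a (r - δ)| = (a (r - δ) - a r) + 2 * (Ioc 0 δ).indicator a r := by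
    intro r
    rcases le_or_gt r 0 with h | h
    · rw [haz r h, haz (r - δ) (by linarith), indicator_of_notMem (by simp [h])]
      simp
    · rcases le_or_gt r δ with h' | h'
      · rw [haz (r - δ) (by linarith), indicator_of_mem (show r ∈ Ioc 0 δ from ⟨h, h'⟩), sub_zero,
          abs_of_nonneg (ha0 r)]
        ring
      · rw [indicator_of_notMem (by simp [h']), abs_sub_comm, abs_of_nonneg]
        · ring
        · have := ha (show r - δ ∈ Ioi 0 from sub_pos.2 h') (show r ∈ Ioi 0 from h) (by linarith)
          linarith
  have hindi : Integrable ((Ioc 0 δ).indicator a) := hai.indicator measurableSet_Ioc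
  have hle : ‖2 * ∫ r : ℝ, (a r : ℂ) * cexp (τ * I * r)‖ ≤ 2 * ∫ r in Ioc 0 δ, a r := by
    rw [htwo]
    refine (norm_integral_le_integral_norm _).trans (le_of_eq ?_)
    have : ∀ r : ℝ, ‖((a r - a (r - δ) : ℝ) : ℂ) * cexp (τ * I * r)‖
        = (a (r - δ) - a r) + 2 * (Ioc 0 δ).indicator a r := by
      intro r
      rw [norm_mul, hnorm, mul_one, norm_real, Real.norm_eq_abs, habs]
    simp only [this]
    have hsub : Integrable fun r => a (r - δ) - a r := (hai.comp_sub_right δ).sub hai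
    rw [integral_add hsub (hindi.const_mul 2),
      integral_sub (hai.comp_sub_right δ) hai, integral_sub_right_eq_self, sub_self, zero_add,
      integral_const_mul, integral_indicator measurableSet_Ioc]
  rw [norm_mul] at hle
  norm_num at hle
  exact hle

/-- No Stirling formula is needed: `symbol` on the line is the Fourier transform of a decreasing
function with singularity `r^{β-1}`, so the half-period bound gives `∫_0^{π/|τ|} r^{β-1} dr`, of
order `|τ|^{-β}`. -/
lemma symbol_vertical_bound {β : ℝ} (hβ : 0 < β) (hβ1 : β ≤ 1) {c : ℝ} (hc : c < 1) :
    ∃ C, 0 ≤ C ∧ ∀ τ : ℝ, ‖symbol β (c + τ * I)‖ ≤ C * (1 + |τ|) ^ (-β) := by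
  have hG := Real.Gamma_pos_of_pos hβ
  set a : ℝ → ℝ := fun r => halfKernel β r * Real.exp (c * r) with ha_def
  have hai : Integrable a := integrable_halfKernel_mul_exp hβ hβ1 hc
  have ha0 : ∀ r, 0 ≤ a r := fun r => mul_nonneg (halfKernel_nonneg hβ r) (Real.exp_pos _).le
  have haz : ∀ r ≤ 0, a r = 0 := fun r hr => by simp [ha_def, halfKernel_of_nonpos β hr]
  have hav : ∀ r, 0 < r → a r
      = Real.exp (-((1 - c) * r)) * (1 - Real.exp (-r)) ^ (β - 1) / Real.Gamma β := by
    intro r hr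
    rw [ha_def]
    simp only
    rw [halfKernel_of_pos β hr, show -((1 - c) * r) = -r + c * r by ring, Real.exp_add]
    ring
  have ha : AntitoneOn a (Ioi 0) := by
    intro x hx y hy hxy
    have hx : 0 < x := hx
    have hy : 0 < y := hy
    rw [hav x hx, hav y hy]
    have h1 := one_sub_exp_neg_rpow_antitone hβ1 hx hxy
    have h2 := one_sub_exp_neg_pos hy
    have h3 : 0 ≤ 1 - c := by linarith
    gcongr
  have hsym : ∀ τ : ℝ, symbol β (c + τ * I) = ∫ r : ℝ, (a r : ℂ) * cexp (τ * I * r) := by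
    intro τ
    rw [symbol]
    refine integral_congr_ae (Filter.Eventually.of_forall fun r => ?_)
    simp only [ha_def]
    push_cast
    rw [show ((c : ℂ) + τ * I) * r = c * r + τ * I * r by ring, Complex.exp_add]
    ring
  have hle1 : ∀ τ : ℝ, ‖symbol β (c + τ * I)‖ ≤ ∫ r, a r := by
    intro τ
    rw [hsym]
    refine (norm_integral_le_integral_norm _).trans (le_of_eq ?_)
    refine integral_congr_ae (Filter.Eventually.of_forall fun r => ?_)
    simp only
    rw [norm_mul, show (τ : ℂ) * I * r = (τ * r : ℝ) * I by push_cast; ring,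
      norm_exp_ofReal_mul_I, norm_real, Real.norm_of_nonneg (ha0 r), mul_one]
  have hsmall : ∀ r, 0 < r → r ≤ 1 → a r ≤ 2 / Real.Gamma β * r ^ (β - 1) := by
    intro r hr hr1
    rw [hav r hr]
    have h1 : Real.exp (-((1 - c) * r)) ≤ 1 := Real.exp_le_one_iff.2 (by nlinarith)
    have h2 : (1 - Real.exp (-r)) ^ (β - 1) ≤ 2 * r ^ (β - 1) :=
      (one_sub_exp_neg_rpow_le hβ hβ1 hr).trans (by gcongr; linarith)
    have h3 := one_sub_exp_neg_pos hr
    calc _ ≤ 1 * (2 * r ^ (β - 1)) / Real.Gamma β := by gcongr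
      _ = _ := by ring
  have hpi := Real.pi_pos
  have hle2 : ∀ τ : ℝ, Real.pi ≤ |τ| →
      ‖symbol β (c + τ * I)‖ ≤ 2 / Real.Gamma β * ((Real.pi / |τ|) ^ β / β) := by
    intro τ hτ
    have hτ0 : 0 < |τ| := hpi.trans_le hτ
    have hδ1 : Real.pi / |τ| ≤ 1 := (div_le_one hτ0).2 hτ
    have hδ0 : 0 < Real.pi / |τ| := by positivity
    rw [hsym]
    refine (norm_integral_antitone_mul_cexp_le ha0 ha haz hai (abs_pos.1 hτ0)).trans ?_
    have hii : IntervalIntegrable (fun r : ℝ => r ^ (β - 1)) volume 0 (Real.pi / |τ|) :=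
      intervalIntegral.intervalIntegrable_rpow' (by linarith)
    have h5 : ∫ r in Ioc 0 (Real.pi / |τ|), a r
        ≤ ∫ r in Ioc 0 (Real.pi / |τ|), 2 / Real.Gamma β * r ^ (β - 1) := by
      refine setIntegral_mono_on hai.integrableOn ?_ measurableSet_Ioc fun r hr => ?_
      · exact ((intervalIntegrable_iff_integrableOn_Ioc_of_le hδ0.le).1 hii).const_mul _
      · exact hsmall r hr.1 (hr.2.trans hδ1)
    refine h5.trans (le_of_eq ?_)
    rw [integral_const_mul, ← intervalIntegral.integral_of_le hδ0.le,
      integral_rpow (Or.inl (by linarith))]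
    simp [hβ.ne']
  have hI : 0 ≤ ∫ r, a r := integral_nonneg ha0
  -- The first summand serves `|τ| < π` through the trivial bound, the second `|τ| ≥ π`, where
  -- `π/|τ| ≤ 2π/(1+|τ|)`.
  refine ⟨(∫ r, a r) * (1 + Real.pi) ^ β + 2 / Real.Gamma β * ((2 * Real.pi) ^ β / β), by positivity,
    fun τ => ?_⟩
  have hτ1 : 0 < 1 + |τ| := by positivity
  rcases le_or_gt Real.pi |τ| with h | h
  · refine (hle2 τ h).trans ?_
    have h6 : (Real.pi / |τ|) ^ β ≤ (2 * Real.pi) ^ β * (1 + |τ|) ^ (-β) := by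
      rw [Real.rpow_neg hτ1.le, ← div_eq_mul_inv, ← Real.div_rpow (by positivity) hτ1.le]
      refine Real.rpow_le_rpow (by positivity) ?_ hβ.le
      rw [div_le_div_iff₀ (hpi.trans_le h) hτ1]
      nlinarith [Real.pi_gt_three]
    calc 2 / Real.Gamma β * ((Real.pi / |τ|) ^ β / β)
        ≤ 2 / Real.Gamma β * (((2 * Real.pi) ^ β * (1 + |τ|) ^ (-β)) / β) := by gcongr
      _ = 0 + 2 / Real.Gamma β * ((2 * Real.pi) ^ β / β) * (1 + |τ|) ^ (-β) := by ring
      _ ≤ _ := by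
        rw [add_mul]
        gcongr
        positivity
  · refine (hle1 τ).trans ?_
    have h7 : 1 ≤ (1 + Real.pi) ^ β * (1 + |τ|) ^ (-β) := by
      rw [Real.rpow_neg hτ1.le, ← div_eq_mul_inv, ← Real.div_rpow (by positivity) hτ1.le]
      refine Real.one_le_rpow ?_ hβ.le
      rw [le_div_iff₀ hτ1]
      linarith
    calc ∫ r, a r ≤ (∫ r, a r) * ((1 + Real.pi) ^ β * (1 + |τ|) ^ (-β)) :=
          le_mul_of_one_le_right hI h7
      _ = (∫ r, a r) * (1 + Real.pi) ^ β * (1 + |τ|) ^ (-β) + 0 := by ring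
      _ ≤ _ := by
        rw [add_mul]
        gcongr
        positivity

lemma continuous_symbol_vertical {β : ℝ} (hβ : 0 < β) (hβ1 : β ≤ 1) {c : ℝ} (hc : c < 1) :
    Continuous fun τ : ℝ => symbol β (c + τ * I) := by
  unfold symbol
  refine continuous_of_dominated (bound := fun r => halfKernel β r * Real.exp (c * r)) ?_ ?_
    (integrable_halfKernel_mul_exp hβ hβ1 hc) ?_
  · intro τ
    exact ((measurable_halfKernel β).complex_ofReal.mul (by fun_prop)).aestronglyMeasurable
  · intro τ
    refine Filter.Eventually.of_forall fun r => ?_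
    rw [norm_mul, norm_real, Real.norm_of_nonneg (halfKernel_nonneg hβ r), Complex.norm_exp]
    simp
  · refine Filter.Eventually.of_forall fun r => ?_
    fun_prop

/-! ### The convolution square: monotonicity, continuity, transform -/

lemma logKernel_nonneg {β : ℝ} (hβ : 0 < β) (r : ℝ) : 0 ≤ logKernel β r :=
  integral_nonneg fun y => mul_nonneg (halfKernel_nonneg hβ y) (halfKernel_nonneg hβ _)

lemma halfKernel_mul_eq_zero (β : ℝ) {r y : ℝ} (h : y ∉ Ioo 0 r) :
    halfKernel β y * halfKernel β (r - y) = 0 := by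
  rcases le_or_gt y 0 with h0 | h0
  · simp [halfKernel_of_nonpos β h0]
  · have : r ≤ y := by
      by_contra h'
      exact h ⟨h0, not_le.1 h'⟩
    simp [halfKernel_of_nonpos β (sub_nonpos.2 this)]

lemma logKernel_of_nonpos (β : ℝ) {r : ℝ} (hr : r ≤ 0) : logKernel β r = 0 := by
  rw [logKernel]
  refine integral_eq_zero_of_ae (Filter.Eventually.of_forall fun y => ?_)
  exact halfKernel_mul_eq_zero β fun h => absurd (h.1.trans h.2) (not_lt.2 hr)

/-- Rescaling puts the support of the integrand in the fixed interval `(0, 1)` and makes it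
decreasing in `r`. Monotonicity of `logKernel β r / r` and the domination needed for continuity are
read off from this form. -/
lemma logKernel_eq_mul_integral (β : ℝ) {r : ℝ} (hr : 0 < r) :
    logKernel β r = r * ∫ u, halfKernel β (r * u) * halfKernel β (r * (1 - u)) := by
  have := Measure.integral_comp_mul_left (fun y => halfKernel β y * halfKernel β (r - y)) r
  rw [abs_of_pos (inv_pos.2 hr), smul_eq_mul] at this
  rw [logKernel]
  simp only [mul_sub, mul_one]
  rw [this]
  field_simp

lemma integrable_rpow_mul_one_sub_rpow {β : ℝ} (hβ : 0 < β) :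
    IntegrableOn (fun u : ℝ => u ^ (β - 1) * (1 - u) ^ (β - 1)) (Ioo 0 1) := by
  have h := Complex.betaIntegral_convergent (u := β) (v := β) (by simpa) (by simpa)
  rw [intervalIntegrable_iff_integrableOn_Ioo_of_le zero_le_one] at h
  refine IntegrableOn.congr_fun (Integrable.norm h) (fun u hu => ?_) measurableSet_Ioo
  have h1 : 0 < 1 - u := sub_pos.2 hu.2
  rw [show (β : ℂ) - 1 = ((β - 1 : ℝ) : ℂ) by push_cast; rfl,
    show (1 : ℂ) - u = ((1 - u : ℝ) : ℂ) by push_cast; rfl, ← ofReal_cpow hu.1.le,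
    ← ofReal_cpow h1.le, ← ofReal_mul, norm_real, Real.norm_of_nonneg]
  have := hu.1
  positivity

lemma integrable_halfKernel_scaled {β : ℝ} (hβ : 0 < β) (hβ1 : β ≤ 1) {r : ℝ} (hr : 0 < r) :
    Integrable fun u => halfKernel β (r * u) * halfKernel β (r * (1 - u)) := by
  have hG := Real.Gamma_pos_of_pos hβ
  have hm : Measurable fun u => halfKernel β (r * u) * halfKernel β (r * (1 - u)) :=
    ((measurable_halfKernel β).comp (by fun_prop)).mul ((measurable_halfKernel β).comp (by fun_prop))
  have hz : ∀ u, u ∉ Ioo (0 : ℝ) 1 → halfKernel β (r * u) * halfKernel β (r * (1 - u)) = 0 := by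
    intro u hu
    rw [mul_sub, mul_one]
    refine halfKernel_mul_eq_zero β fun h => hu ⟨?_, ?_⟩
    · exact pos_of_mul_pos_right h.1 hr.le
    · have := h.2
      by_contra h'
      nlinarith
  have hle : ∀ x, 0 < x → x ≤ r → halfKernel β x ≤ (1 + r) / Real.Gamma β * x ^ (β - 1) := by
    intro x hx hxr
    refine (halfKernel_le hβ hβ1 hx).trans ?_
    have h1 : Real.exp (-x) ≤ 1 := Real.exp_le_one_iff.2 (by linarith)
    calc Real.exp (-x) * ((1 + x) * x ^ (β - 1)) / Real.Gamma β
        ≤ 1 * ((1 + r) * x ^ (β - 1)) / Real.Gamma β := by gcongr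
      _ = _ := by ring
  have h4 : IntegrableOn (fun u => halfKernel β (r * u) * halfKernel β (r * (1 - u))) (Ioo 0 1) := by
    refine Integrable.mono' ((integrable_rpow_mul_one_sub_rpow hβ).const_mul
      (((1 + r) / Real.Gamma β * r ^ (β - 1)) ^ 2)) hm.aestronglyMeasurable ?_
    refine (ae_restrict_iff' measurableSet_Ioo).2 (Filter.Eventually.of_forall fun u hu => ?_)
    have h1 : 0 < 1 - u := sub_pos.2 hu.2
    have h0 : 0 < u := hu.1
    have hu2 := hu.2
    rw [Real.norm_of_nonneg (mul_nonneg (halfKernel_nonneg hβ _) (halfKernel_nonneg hβ _))]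
    calc halfKernel β (r * u) * halfKernel β (r * (1 - u))
        ≤ ((1 + r) / Real.Gamma β * (r * u) ^ (β - 1)) *
          ((1 + r) / Real.Gamma β * (r * (1 - u)) ^ (β - 1)) := by
          refine mul_le_mul (hle _ (by positivity) (by nlinarith)) (hle _ (by positivity)
            (by nlinarith)) (halfKernel_nonneg hβ _) (by positivity)
      _ = _ := by
          rw [Real.mul_rpow hr.le h0.le, Real.mul_rpow hr.le h1.le]
          ring
  refine (integrableOn_iff_integrable_of_support_subset ?_).1 h4
  intro u hu
  by_contra h
  exact hu (hz u h)

lemma halfKernel_scaled_le {β : ℝ} (hβ : 0 < β) (hβ1 : β ≤ 1) {a b : ℝ} (ha : 0 < a) (hab : a ≤ b)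
    (u : ℝ) : halfKernel β (b * u) * halfKernel β (b * (1 - u))
      ≤ halfKernel β (a * u) * halfKernel β (a * (1 - u)) := by
  have key : ∀ v : ℝ, halfKernel β (b * v) ≤ halfKernel β (a * v) := by
    intro v
    rcases le_or_gt v 0 with h | h
    · rw [halfKernel_of_nonpos β (by nlinarith), halfKernel_of_nonpos β (by nlinarith)]
    · have hb : 0 < b := ha.trans_le hab
      exact halfKernel_antitoneOn hβ hβ1 (mul_pos ha h) (mul_pos hb h) (by gcongr)
  exact mul_le_mul (key u) (key _) (halfKernel_nonneg hβ _) (halfKernel_nonneg hβ _)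

/-- The function `r ↦ logKernel β r / r` is decreasing. -/
lemma logKernel_le_div_mul {β : ℝ} (hβ : 0 < β) (hβ1 : β ≤ 1) {a b : ℝ} (ha : 0 < a) (hab : a ≤ b) :
    logKernel β b ≤ b / a * logKernel β a := by
  have hb : 0 < b := ha.trans_le hab
  rw [logKernel_eq_mul_integral β hb, logKernel_eq_mul_integral β ha, ← mul_assoc,
    div_mul_cancel₀ _ ha.ne']
  gcongr
  · exact integrable_halfKernel_scaled hβ hβ1 hb
  · exact integrable_halfKernel_scaled hβ hβ1 ha
  · intro u
    exact halfKernel_scaled_le hβ hβ1 ha hab u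

lemma continuousAt_logKernel {β : ℝ} (hβ : 0 < β) (hβ1 : β ≤ 1) {r : ℝ} (hr : 0 < r) :
    ContinuousAt (logKernel β) r := by
  have h : ContinuousAt
      (fun r => r * ∫ u, halfKernel β (r * u) * halfKernel β (r * (1 - u))) r := by
    refine continuousAt_id.mul ?_
    -- By monotonicity in the scale, the integrand at `r / 2` dominates those at all nearby scales.
    refine continuousAt_of_dominated
      (bound := fun u => halfKernel β (r / 2 * u) * halfKernel β (r / 2 * (1 - u))) ?_ ?_
      (integrable_halfKernel_scaled hβ hβ1 (by positivity)) ?_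
    · refine Filter.Eventually.of_forall fun x => ?_
      exact (((measurable_halfKernel β).comp (by fun_prop)).mul
        ((measurable_halfKernel β).comp (by fun_prop))).aestronglyMeasurable
    · filter_upwards [Ioi_mem_nhds (show r / 2 < r by linarith)] with x hx
      refine Filter.Eventually.of_forall fun u => ?_
      rw [Real.norm_of_nonneg (mul_nonneg (halfKernel_nonneg hβ _) (halfKernel_nonneg hβ _))]
      exact halfKernel_scaled_le hβ hβ1 (by positivity) (le_of_lt hx) u
    · have h0 : ∀ᵐ u : ℝ, u ≠ 0 := by simp [ae_iff]
      have h1 : ∀ᵐ u : ℝ, u ≠ 1 := by simp [ae_iff]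
      filter_upwards [h0, h1] with u hu0 hu1
      refine ContinuousAt.mul ?_ ?_
      · exact ContinuousAt.comp (f := fun x : ℝ => x * u)
          (continuousAt_halfKernel β (mul_ne_zero hr.ne' hu0)) (by fun_prop)
      · exact ContinuousAt.comp (f := fun x : ℝ => x * (1 - u))
          (continuousAt_halfKernel β (mul_ne_zero hr.ne' (sub_ne_zero.2 hu1.symm))) (by fun_prop)
  refine h.congr ?_
  filter_upwards [Ioi_mem_nhds hr] with x hx
  exact (logKernel_eq_mul_integral β hx).symm

lemma convolution_halfKernel_mul_cexp (β : ℝ) (z : ℂ) :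
    convolution (fun r : ℝ => (halfKernel β r : ℂ) * cexp (z * r))
      (fun r : ℝ => (halfKernel β r : ℂ) * cexp (z * r)) (ContinuousLinearMap.mul ℝ ℂ) volume
      = fun r : ℝ => (logKernel β r : ℂ) * cexp (z * r) := by
  funext r
  rw [convolution_def, logKernel, ← integral_complex_ofReal, ← integral_mul_const]
  refine integral_congr_ae (Filter.Eventually.of_forall fun y => ?_)
  simp only [ContinuousLinearMap.mul_apply']
  push_cast
  rw [show z * r = z * y + z * (r - y) by ring, Complex.exp_add]
  ring

lemma integrable_logKernel_mul_cexp {β : ℝ} (hβ : 0 < β) (hβ1 : β ≤ 1) {z : ℂ} (hz : z.re < 1) :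
    Integrable fun r : ℝ => (logKernel β r : ℂ) * cexp (z * r) := by
  have h := integrable_halfKernel_mul_cexp hβ hβ1 hz
  rw [← convolution_halfKernel_mul_cexp]
  exact h.integrable_convolution _ h

lemma integrable_logKernel_mul_exp {β : ℝ} (hβ : 0 < β) (hβ1 : β ≤ 1) {c : ℝ} (hc : c < 1) :
    Integrable fun r : ℝ => logKernel β r * Real.exp (c * r) := by
  have h := (integrable_logKernel_mul_cexp hβ hβ1 (z := c) (by simpa)).re
  refine h.congr (Filter.Eventually.of_forall fun r => ?_)
  simp only
  rw [← ofReal_mul, ← ofReal_exp, ← ofReal_mul]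
  exact ofReal_re _

lemma integral_logKernel_mul_cexp {β : ℝ} (hβ : 0 < β) (hβ1 : β ≤ 1) {z : ℂ} (hz : z.re < 1) :
    ∫ r : ℝ, (logKernel β r : ℂ) * cexp (z * r) = symbol β z ^ 2 := by
  have h := integrable_halfKernel_mul_cexp hβ hβ1 hz
  rw [← convolution_halfKernel_mul_cexp, integral_convolution _ h h]
  simp [symbol, sq]

lemma measurable_logKernel {β : ℝ} (hβ : 0 < β) (hβ1 : β ≤ 1) : Measurable (logKernel β) := by
  have h : ContinuousOn (logKernel β) (Ioi 0) := fun r hr =>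
    (continuousAt_logKernel hβ hβ1 hr).continuousWithinAt
  have h2 : Measurable ((Ioi (0 : ℝ)).indicator (logKernel β)) := by
    classical
    rw [← piecewise_eq_indicator]
    exact h.measurable_piecewise continuousOn_const measurableSet_Ioi
  convert h2 using 1
  funext r
  by_cases hr : r ∈ Ioi (0 : ℝ)
  · rw [indicator_of_mem hr]
  · rw [indicator_of_notMem hr, logKernel_of_nonpos β (not_lt.1 hr)]

/-! ### The functional equation and the hypergeometric form of the kernel -/

/-- The difference of the two sides is the integral over `(0, ∞)` of the derivative of `e^{zr} (1 -
e^{-r})^β / Γ(β)`, which vanishes at `0` since `β > 0` and at infinity since `Re z < 0`. -/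
lemma symbol_functional_equation {β : ℝ} (hβ : 0 < β) (hβ1 : β ≤ 1) {z : ℂ} (hz : z.re < 0) :
    z * symbol β (z + 1) = (z - β) * symbol β z := by
  have hG := Real.Gamma_pos_of_pos hβ
  set F : ℝ → ℂ := fun r => cexp (z * r) * (((1 - Real.exp (-r)) ^ β / Real.Gamma β : ℝ) : ℂ)
  set F' : ℝ → ℂ := fun r => z * ((halfKernel β r : ℂ) * cexp ((z + 1) * r))
    - (z - β) * ((halfKernel β r : ℂ) * cexp (z * r))
  have hi1 := integrable_halfKernel_mul_cexp hβ hβ1 (z := z + 1) (by simpa)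
  have hi0 := integrable_halfKernel_mul_cexp hβ hβ1 (z := z) (by linarith)
  have hF'i : Integrable F' := (hi1.const_mul z).sub (hi0.const_mul (z - β))
  have hcont : Continuous F := by
    refine Continuous.mul (by fun_prop) (continuous_ofReal.comp ?_)
    exact ((Real.continuous_rpow_const hβ.le).comp (by fun_prop)).div_const _
  have hder : ∀ r ∈ Ioi (0 : ℝ), HasDerivAt F (F' r) r := by
    intro r hr
    have hr : 0 < r := hr
    have hp := one_sub_exp_neg_pos hr
    have h1 : HasDerivAt (fun r : ℝ => (1 - Real.exp (-r))) (Real.exp (-r)) r := by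
      have := ((hasDerivAt_neg r).exp).const_sub 1
      simpa using this
    have h2 := ((h1.rpow_const (p := β) (Or.inl hp.ne')).div_const (Real.Gamma β)).ofReal_comp
    have h3 : HasDerivAt (fun r : ℝ => cexp (z * r)) (cexp (z * r) * z) r := by
      have := ((hasDerivAt_id r).ofReal_comp.const_mul z).cexp
      simpa using this
    refine (h3.mul h2).congr_deriv ?_
    simp only [F', halfKernel_of_pos β hr]
    have e1 : (1 - Real.exp (-r)) ^ β = (1 - Real.exp (-r)) ^ (β - 1) * (1 - Real.exp (-r)) := by
      rw [Real.rpow_sub_one hp.ne']; field_simp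
    have e2 : cexp ((z + 1) * r) = cexp (z * r) * cexp r := by
      rw [← Complex.exp_add]; ring_nf
    rw [e1, e2]
    push_cast
    have e3 : cexp (-(r : ℂ)) * cexp r = 1 := by rw [← Complex.exp_add]; simp
    linear_combination (-(z * cexp (z * r) * (((1 - Real.exp (-r)) ^ (β - 1) : ℝ) : ℂ)
      / (Real.Gamma β : ℂ))) * e3
  have hlim : Filter.Tendsto F Filter.atTop (nhds 0) := by
    rw [tendsto_zero_iff_norm_tendsto_zero]
    have hb : Filter.Tendsto (fun r : ℝ => Real.exp (z.re * r) * (1 / Real.Gamma β)) Filter.atTop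
        (nhds 0) := by
      have h1 : Filter.Tendsto (fun r : ℝ => z.re * r) Filter.atTop Filter.atBot :=
        Filter.tendsto_id.const_mul_atTop_of_neg hz
      simpa using (Real.tendsto_exp_atBot.comp h1).mul_const (1 / Real.Gamma β)
    refine tendsto_of_tendsto_of_tendsto_of_le_of_le' tendsto_const_nhds hb
      (Filter.Eventually.of_forall fun r => norm_nonneg _) ?_
    filter_upwards [Filter.eventually_gt_atTop 0] with r hr
    have hp := one_sub_exp_neg_pos hr
    simp only [F]
    rw [norm_mul, Complex.norm_exp, norm_real, Real.norm_of_nonneg (by positivity)]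
    have : (1 - Real.exp (-r)) ^ β ≤ 1 :=
      Real.rpow_le_one hp.le (by linarith [Real.exp_pos (-r)]) hβ.le
    have e : (z * (r : ℂ)).re = z.re * r := by simp
    rw [e]
    gcongr
  have hfin := integral_Ioi_of_hasDerivAt_of_tendsto hcont.continuousWithinAt hder
    hF'i.integrableOn hlim
  have hF0 : F 0 = 0 := by simp [F, Real.zero_rpow hβ.ne']
  have hall : ∫ r in Ioi (0 : ℝ), F' r = ∫ r, F' r := by
    refine setIntegral_eq_integral_of_forall_compl_eq_zero fun r hr => ?_
    simp [F', halfKernel_of_nonpos β (not_lt.1 hr)]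
  rw [hall, hF0, sub_zero] at hfin
  simp only [F'] at hfin
  rw [integral_sub (hi1.const_mul z) (hi0.const_mul (z - β)), integral_const_mul,
    integral_const_mul] at hfin
  exact sub_eq_zero.1 hfin

/-- The substitution `y = log (1 + (e^r - 1) τ)` maps `(0, 1)` onto `(0, r)` and turns the
convolution integral into Euler's integral at the argument `1 - e^r`. -/
lemma logKernel_eq_hypergeometric {β : ℝ} {r : ℝ} (hr : 0 < r) :
    logKernel β r = Real.exp r ^ (-β) * (Real.exp r - 1) ^ (2 * β - 1) / Real.Gamma β ^ 2 *
      ∫ τ in Ioo (0 : ℝ) 1, τ ^ (β - 1) * (1 - τ) ^ (β - 1) *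
        (1 - (1 - Real.exp r) * τ) ^ (-β) := by
  set E := Real.exp r with hE
  have hE1 : 0 < E - 1 := by
    have := Real.one_lt_exp_iff.2 hr
    linarith
  have hE0 : 0 < E := Real.exp_pos r
  set φ : ℝ → ℝ := fun τ => Real.log (1 + (E - 1) * τ)
  have hP : ∀ τ ∈ Ioo (0 : ℝ) 1, 0 < 1 + (E - 1) * τ := by
    intro τ hτ
    have := hτ.1
    positivity
  have himg : φ '' Ioo 0 1 = Ioo 0 r := by
    ext y
    constructor
    · rintro ⟨τ, hτ, rfl⟩
      have h0 := hτ.1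
      have h1 := hτ.2
      refine ⟨Real.log_pos (by nlinarith), ?_⟩
      rw [← Real.log_exp r]
      exact Real.log_lt_log (hP τ hτ) (by nlinarith)
    · intro hy
      have h1 : 1 < Real.exp y := Real.one_lt_exp_iff.2 hy.1
      have h2 : Real.exp y < E := Real.exp_lt_exp.2 hy.2
      refine ⟨(Real.exp y - 1) / (E - 1), ⟨div_pos (by linarith) hE1, ?_⟩, ?_⟩
      · rw [div_lt_one hE1]; linarith
      · simp only [φ]
        rw [mul_div_cancel₀ _ hE1.ne', add_sub_cancel, Real.log_exp]
  have hder : ∀ τ ∈ Ioo (0 : ℝ) 1,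
      HasDerivWithinAt φ ((E - 1) / (1 + (E - 1) * τ)) (Ioo 0 1) τ := by
    intro τ hτ
    have h := (((hasDerivAt_id τ).const_mul (E - 1)).const_add 1).log (hP τ hτ).ne'
    simpa using h.hasDerivWithinAt
  have hinj : InjOn φ (Ioo 0 1) := by
    intro a ha b hb hab
    have := Real.log_injOn_pos (hP a ha) (hP b hb) hab
    have h2 : (E - 1) * a = (E - 1) * b := by linarith
    exact mul_left_cancel₀ hE1.ne' h2
  have h1 : logKernel β r = ∫ y in Ioo 0 r, halfKernel β y * halfKernel β (r - y) :=
    (setIntegral_eq_integral_of_forall_compl_eq_zero fun y hy => halfKernel_mul_eq_zero β hy).symm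
  rw [h1, ← himg, integral_image_eq_integral_abs_deriv_smul measurableSet_Ioo hder hinj,
    ← integral_const_mul]
  refine setIntegral_congr_fun measurableSet_Ioo fun τ hτ => ?_
  have hφ : φ τ ∈ Ioo 0 r := himg ▸ mem_image_of_mem φ hτ
  have hPτ := hP τ hτ
  have h0 := hτ.1
  have h1' : 0 < 1 - τ := sub_pos.2 hτ.2
  simp only [smul_eq_mul]
  rw [halfKernel_of_pos β hφ.1, halfKernel_of_pos β (sub_pos.2 hφ.2)]
  set P := 1 + (E - 1) * τ with hPdef
  have e1 : Real.exp (-φ τ) = P⁻¹ := by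
    simp only [φ]
    rw [Real.exp_neg, Real.exp_log hPτ]
  have e2 : Real.exp (-(r - φ τ)) = P / E := by
    simp only [φ]
    rw [neg_sub, Real.exp_sub, Real.exp_log hPτ]
  have e3 : 1 - P⁻¹ = (E - 1) * τ / P := by
    rw [hPdef]; field_simp; ring
  have e4 : 1 - P / E = (E - 1) * (1 - τ) / E := by
    rw [hPdef]; field_simp; ring
  have e5 : 1 - (1 - E) * τ = P := by rw [hPdef]; ring
  rw [e1, e2, e3, e4, e5, abs_of_pos (by positivity), Real.div_rpow (by positivity) hPτ.le,
    Real.div_rpow (by positivity) hE0.le, Real.mul_rpow hE1.le h0.le, Real.mul_rpow hE1.le h1'.le,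
    show 2 * β - 1 = (β - 1) + (β - 1) + 1 by ring, Real.rpow_add hE1, Real.rpow_add hE1,
    Real.rpow_one, Real.rpow_neg hE0.le, Real.rpow_neg hPτ.le, Real.rpow_sub_one hE0.ne' β,
    Real.rpow_sub_one hPτ.ne' β]
  have := Real.rpow_pos_of_pos hE0 β
  have := Real.rpow_pos_of_pos hPτ β
  field_simp

/-- Serves both fractional integrals: with the two variables exchanged, and up to exponential
factors, this is also the right-sided kernel. The last factor on the left is the Jacobian of `u =
e^s`. -/
lemma laguerreKernel_exp {β : ℝ} (hβ : 0 < β) {s t : ℝ} (hst : s < t) :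
    1 / Real.Gamma (2 * β) * ((Real.exp t - Real.exp s) ^ (2 * β - 1) * Real.exp s ^ (-β) *
      gaussHypergeometric β β (2 * β) (1 - Real.exp t / Real.exp s)) * Real.exp s
      = Real.exp (β * t) * logKernel β (t - s) := by
  have hG := Real.Gamma_pos_of_pos hβ
  have hG2 := Real.Gamma_pos_of_pos (show 0 < 2 * β by positivity)
  have hE1 : 0 < Real.exp (t - s) - 1 := by
    have := Real.one_lt_exp_iff.2 (sub_pos.2 hst)
    linarith
  rw [logKernel_eq_hypergeometric (sub_pos.2 hst), gaussHypergeometric, ← Real.exp_sub,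
    show 2 * β - β = β by ring]
  have e1 : Real.exp t - Real.exp s = Real.exp s * (Real.exp (t - s) - 1) := by
    rw [Real.exp_sub]; field_simp
  rw [e1, Real.mul_rpow (Real.exp_pos s).le hE1.le, ← Real.exp_mul, ← Real.exp_mul, ← Real.exp_mul]
  have e2 : Real.exp (β * t) * Real.exp ((t - s) * -β) = Real.exp (β * s) := by
    rw [← Real.exp_add]; ring_nf
  have e3 : Real.exp (s * (2 * β - 1)) * Real.exp (s * -β) * Real.exp s = Real.exp (β * s) := by
    rw [← Real.exp_add, ← Real.exp_add]; ring_nf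
  set J := ∫ τ in Ioo (0 : ℝ) 1, τ ^ (β - 1) * (1 - τ) ^ (β - 1) *
        (1 - (1 - Real.exp (t - s)) * τ) ^ (-β)
  set K := (Real.exp (t - s) - 1) ^ (2 * β - 1)
  calc _ = (Real.exp (s * (2 * β - 1)) * Real.exp (s * -β) * Real.exp s) * K * J
        / Real.Gamma β ^ 2 := by field_simp
    _ = (Real.exp (β * t) * Real.exp ((t - s) * -β)) * K * J / Real.Gamma β ^ 2 := by
        rw [e3, e2]
    _ = _ := by ring

/-! ### Mellin transforms and their inverses on vertical lines -/

/-- The two-sided Laplace transform of `F` along the line `Re s = c`. For `F = f ∘ exp` this is the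
Mellin transform of `f` at `c + iτ`. -/
noncomputable def lineTransform (c : ℝ) (F : ℝ → ℂ) (τ : ℝ) : ℂ :=
  ∫ t : ℝ, F t * cexp ((c + τ * I) * t)

/-- The inverse two-sided Laplace transform along the line `Re s = c`. -/
noncomputable def lineInverse (c : ℝ) (φ : ℝ → ℂ) (t : ℝ) : ℂ :=
  (2 * Real.pi : ℂ)⁻¹ * ∫ τ : ℝ, φ τ * cexp (-(c + τ * I) * t)

/-- Integrability with respect to the weight `e^{at}`. -/
def ExpIntegrable (a : ℝ) (F : ℝ → ℂ) : Prop := Integrable fun t : ℝ => F t * cexp (a * t)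

/-- Integrability with respect to the weight `(1 + |τ|)^a`. -/
def WeightedIntegrable (a : ℝ) (φ : ℝ → ℂ) : Prop :=
  Integrable fun τ : ℝ => (((1 + |τ|) ^ a : ℝ) : ℂ) * φ τ

lemma continuous_weight (a : ℝ) : Continuous fun τ : ℝ => (((1 + |τ|) ^ a : ℝ) : ℂ) := by
  refine continuous_ofReal.comp (Continuous.rpow_const (by fun_prop) fun τ => Or.inl ?_)
  positivity

lemma WeightedIntegrable.aestronglyMeasurable {a : ℝ} {φ : ℝ → ℂ} (h : WeightedIntegrable a φ) :
    AEStronglyMeasurable φ := by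
  have := (continuous_weight (-a)).aestronglyMeasurable.mul (Integrable.aestronglyMeasurable h)
  refine this.congr (Filter.Eventually.of_forall fun τ => ?_)
  have h0 : 0 < 1 + |τ| := by positivity
  simp only [Pi.mul_apply]
  rw [← mul_assoc, ← ofReal_mul, ← Real.rpow_add h0]
  simp

lemma WeightedIntegrable.mul_of_bound {a b C : ℝ} {φ P : ℝ → ℂ} (h : WeightedIntegrable a φ)
    (hP : Continuous P) (hb : ∀ τ, ‖P τ‖ ≤ C * (1 + |τ|) ^ b) :
    WeightedIntegrable (a - b) fun τ => P τ * φ τ := by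
  have hC : Integrable fun τ => C * ‖(((1 + |τ|) ^ a : ℝ) : ℂ) * φ τ‖ :=
    (Integrable.norm h).const_mul C
  refine Integrable.mono' hC ?_ (Filter.Eventually.of_forall fun τ => ?_)
  · exact (continuous_weight _).aestronglyMeasurable.mul
      (hP.aestronglyMeasurable.mul h.aestronglyMeasurable)
  · have h0 : 0 < 1 + |τ| := by positivity
    rw [norm_mul, norm_mul, norm_mul, norm_real, norm_real,
      Real.norm_of_nonneg (Real.rpow_nonneg h0.le _), Real.norm_of_nonneg (Real.rpow_nonneg h0.le _)]
    calc (1 + |τ|) ^ (a - b) * (‖P τ‖ * ‖φ τ‖)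
        ≤ (1 + |τ|) ^ (a - b) * (C * (1 + |τ|) ^ b * ‖φ τ‖) := by
          gcongr
          exact hb τ
      _ = C * ((1 + |τ|) ^ (a - b) * (1 + |τ|) ^ b * ‖φ τ‖) := by ring
      _ = _ := by rw [← Real.rpow_add h0, sub_add_cancel]

lemma WeightedIntegrable.mono {a b : ℝ} {φ : ℝ → ℂ} (h : WeightedIntegrable b φ) (hab : a ≤ b) :
    WeightedIntegrable a φ := by
  have := h.mul_of_bound (P := fun _ => 1) (b := b - a) (C := 1) continuous_const fun τ => by
    rw [norm_one, one_mul]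
    exact Real.one_le_rpow (by simp) (by linarith)
  simpa using this

lemma weightedIntegrable_zero {φ : ℝ → ℂ} : WeightedIntegrable 0 φ ↔ Integrable φ := by
  simp [WeightedIntegrable]

lemma WeightedIntegrable.integrable {a : ℝ} {φ : ℝ → ℂ} (h : WeightedIntegrable a φ) (ha : 0 ≤ a) :
    Integrable φ := weightedIntegrable_zero.1 (h.mono ha)

lemma WeightedIntegrable.comp_neg {a : ℝ} {φ : ℝ → ℂ} (h : WeightedIntegrable a φ) :
    WeightedIntegrable a fun τ => φ (-τ) := by
  have := Integrable.comp_neg h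
  simpa [WeightedIntegrable] using this

lemma norm_cexp_line (c τ t : ℝ) : ‖cexp (-(c + τ * I) * t)‖ = Real.exp (-(c * t)) := by
  rw [Complex.norm_exp]; simp

lemma norm_add_mul_I_le (c τ : ℝ) : ‖(c : ℂ) + τ * I‖ ≤ (1 + |c|) * (1 + |τ|) ^ (1 : ℝ) := by
  rw [Real.rpow_one]
  refine (norm_add_le _ _).trans ?_
  rw [norm_mul, norm_I, norm_real, norm_real, mul_one, Real.norm_eq_abs, Real.norm_eq_abs]
  nlinarith [abs_nonneg c, abs_nonneg τ]

lemma integrable_mul_cexp_line {φ : ℝ → ℂ} (hφ : Integrable φ) (c t : ℝ) :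
    Integrable fun τ : ℝ => φ τ * cexp (-(c + τ * I) * t) := by
  refine hφ.mul_bdd (c := Real.exp (-(c * t))) (by fun_prop)
    (Filter.Eventually.of_forall fun τ => ?_)
  exact (norm_cexp_line c τ t).le

lemma norm_lineInverse_le (c : ℝ) (φ : ℝ → ℂ) (t : ℝ) :
    ‖lineInverse c φ t‖ ≤ Real.exp (-(c * t)) * ((2 * Real.pi)⁻¹ * ∫ τ, ‖φ τ‖) := by
  rw [lineInverse, norm_mul]
  have h1 : ‖(2 * Real.pi : ℂ)⁻¹‖ = (2 * Real.pi)⁻¹ := by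
    rw [norm_inv, norm_mul]
    simp [abs_of_pos Real.pi_pos]
  have h2 : ‖∫ τ : ℝ, φ τ * cexp (-(c + τ * I) * t)‖ ≤ Real.exp (-(c * t)) * ∫ τ, ‖φ τ‖ := by
    refine (norm_integral_le_integral_norm _).trans (le_of_eq ?_)
    rw [← integral_const_mul]
    refine integral_congr_ae (Filter.Eventually.of_forall fun τ => ?_)
    simp only
    rw [norm_mul, norm_cexp_line, mul_comm]
  rw [h1]
  have := Real.pi_pos
  calc _ ≤ (2 * Real.pi)⁻¹ * (Real.exp (-(c * t)) * ∫ τ, ‖φ τ‖) := by gcongr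
    _ = _ := by ring

lemma hasDerivAt_lineInverse (c : ℝ) {φ : ℝ → ℂ} (hφ : WeightedIntegrable 1 φ) (t : ℝ) :
    HasDerivAt (lineInverse c φ) (lineInverse c (fun τ => -(c + τ * I) * φ τ) t) t := by
  have hφ0 := hφ.integrable zero_le_one
  have hφ1 : Integrable fun τ : ℝ => -(c + τ * I) * φ τ := by
    have := hφ.mul_of_bound (P := fun τ : ℝ => -(c + τ * I)) (b := 1) (C := 1 + |c|) (by fun_prop)
      fun τ => by rw [norm_neg]; exact norm_add_mul_I_le c τ
    rw [sub_self] at this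
    exact weightedIntegrable_zero.1 this
  refine HasDerivAt.const_mul _ ?_
  have := hasDerivAt_integral_of_dominated_loc_of_deriv_le (μ := volume) (𝕜 := ℝ)
    (F := fun (t : ℝ) (τ : ℝ) => φ τ * cexp (-(c + τ * I) * t))
    (F' := fun (t : ℝ) (τ : ℝ) => (-(c + τ * I) * φ τ) * cexp (-(c + τ * I) * t))
    (x₀ := t) (s := Metric.ball t 1)
    -- For `x` within distance `1` of `t`, the modulus `e^{-cx}` of the exponential is at most
    -- `e^{|c|(|t|+1)}`, uniformly in `τ`.
    (bound := fun τ => ‖-(c + τ * I) * φ τ‖ * Real.exp (|c| * (|t| + 1)))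
    (Metric.ball_mem_nhds t one_pos) ?_ (integrable_mul_cexp_line hφ0 c t) ?_ ?_ ?_ ?_
  · exact this.2
  · exact Filter.Eventually.of_forall fun x =>
      (integrable_mul_cexp_line hφ0 c x).aestronglyMeasurable
  · exact (integrable_mul_cexp_line hφ1 c t).aestronglyMeasurable
  · refine Filter.Eventually.of_forall fun τ x hx => ?_
    rw [norm_mul, norm_cexp_line]
    gcongr
    have h1 : |x| ≤ |t| + 1 := by
      have h2 : |x - t| < 1 := by simpa [Real.dist_eq] using hx
      have h3 := abs_sub_abs_le_abs_sub x t
      linarith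
    calc -(c * x) ≤ |c * x| := neg_le_abs _
      _ = |c| * |x| := abs_mul _ _
      _ ≤ _ := by gcongr
  · exact hφ1.norm.mul_const _
  · refine Filter.Eventually.of_forall fun τ x _ => ?_
    have h := ((((hasDerivAt_id x).ofReal_comp).const_mul (-(c + τ * I))).cexp).const_mul (φ τ)
    refine h.congr_deriv ?_
    simp only [id, ofReal_one, mul_one]
    ring

lemma continuous_lineInverse (c : ℝ) {φ : ℝ → ℂ} (hφ : Integrable φ) :
    Continuous (lineInverse c φ) := by
  refine continuous_const.mul (continuous_iff_continuousAt.2 fun t => ?_)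
  refine continuousAt_of_dominated (bound := fun τ => ‖φ τ‖ * Real.exp (|c| * (|t| + 1))) ?_ ?_
    (hφ.norm.mul_const _) ?_
  · exact Filter.Eventually.of_forall fun x => (integrable_mul_cexp_line hφ c x).aestronglyMeasurable
  · filter_upwards [Metric.ball_mem_nhds t one_pos] with x hx
    refine Filter.Eventually.of_forall fun τ => ?_
    rw [norm_mul, norm_cexp_line]
    gcongr
    have h1 : |x| ≤ |t| + 1 := by
      have h2 : |x - t| < 1 := by simpa [Real.dist_eq] using hx
      have h3 := abs_sub_abs_le_abs_sub x t
      linarith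
    calc -(c * x) ≤ |c * x| := neg_le_abs _
      _ = |c| * |x| := abs_mul _ _
      _ ≤ _ := by gcongr
  · exact Filter.Eventually.of_forall fun τ => by fun_prop

lemma WeightedIntegrable.neg_mul_line {a : ℝ} {φ : ℝ → ℂ} (hφ : WeightedIntegrable a φ) (c : ℝ) :
    WeightedIntegrable (a - 1) fun τ : ℝ => -(c + τ * I) * φ τ :=
  hφ.mul_of_bound (P := fun τ : ℝ => -(c + τ * I)) (b := 1) (C := 1 + |c|) (by fun_prop)
    fun τ => by rw [norm_neg]; exact norm_add_mul_I_le c τ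

lemma deriv_lineInverse (c : ℝ) {φ : ℝ → ℂ} (hφ : WeightedIntegrable 1 φ) :
    deriv (lineInverse c φ) = lineInverse c fun τ : ℝ => -(c + τ * I) * φ τ :=
  funext fun t => (hasDerivAt_lineInverse c hφ t).deriv

lemma contDiff_lineInverse (c : ℝ) (n : ℕ) {φ : ℝ → ℂ} (hφ : WeightedIntegrable n φ) :
    ContDiff ℝ n (lineInverse c φ) := by
  induction n generalizing φ with
  | zero =>
    refine contDiff_zero.2 (continuous_lineInverse c ?_)
    exact hφ.integrable (by simp)
  | succ n ih =>
    have h1 : WeightedIntegrable 1 φ := hφ.mono (by simp)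
    rw [show ((n + 1 : ℕ) : WithTop ℕ∞) = (n : WithTop ℕ∞) + 1 by push_cast; rfl,
      contDiff_succ_iff_deriv]
    refine ⟨fun t => (hasDerivAt_lineInverse c h1 t).differentiableAt, by simp, ?_⟩
    rw [deriv_lineInverse c h1]
    apply ih
    have := hφ.neg_mul_line c
    simpa using this

/-! ### The Laguerre derivative on the Mellin side -/

/-- The Laguerre derivative in the coordinate `t = log x`. -/
noncomputable def logTheta (W : ℝ → ℂ) (t : ℝ) : ℂ := cexp (-t) * deriv (deriv W) t

/-- Each derivative brings down a factor `-(c + iτ)`, and the factor `e^{-t}` moves the line one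
unit to the right. -/
lemma logTheta_lineInverse (c : ℝ) {φ : ℝ → ℂ} (hφ : WeightedIntegrable 2 φ) :
    logTheta (lineInverse c φ) = lineInverse (c + 1) fun τ : ℝ => (c + τ * I) ^ 2 * φ τ := by
  funext t
  have h1 : WeightedIntegrable 1 fun τ : ℝ => -(c + τ * I) * φ τ := by
    have := hφ.neg_mul_line c
    norm_num at this
    simpa using this
  rw [logTheta, deriv_lineInverse c (hφ.mono one_le_two), deriv_lineInverse c h1, lineInverse,
    lineInverse, mul_left_comm, ← integral_const_mul]
  congr 1
  refine integral_congr_ae (Filter.Eventually.of_forall fun τ => ?_)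
  simp only
  push_cast
  rw [show -((c : ℂ) + 1 + τ * I) * t = -t + -(c + τ * I) * t by ring, Complex.exp_add]
  ring

/-- The factor by which `θ^m` multiplies `x^{-s}`, `s = c + iτ`. -/
noncomputable def thetaFactor (m : ℕ) (c τ : ℝ) : ℂ :=
  ∏ j ∈ Finset.range m, ((c : ℂ) + j + τ * I) ^ 2

lemma continuous_thetaFactor (m : ℕ) (c : ℝ) : Continuous (thetaFactor m c) := by
  unfold thetaFactor
  fun_prop

lemma norm_thetaFactor_le (m : ℕ) (c : ℝ) :
    ∃ C, 0 ≤ C ∧ ∀ τ, ‖thetaFactor m c τ‖ ≤ C * (1 + |τ|) ^ (2 * m : ℝ) := by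
  induction m with
  | zero => exact ⟨1, zero_le_one, fun τ => by simp [thetaFactor]⟩
  | succ m ih =>
    obtain ⟨C, hC, h⟩ := ih
    refine ⟨C * (1 + |c + m|) ^ 2, by positivity, fun τ => ?_⟩
    have h0 : 0 < 1 + |τ| := by positivity
    have h2 := norm_add_mul_I_le (c + m) τ
    rw [thetaFactor, Finset.prod_range_succ, ← thetaFactor, norm_mul, norm_pow]
    push_cast at h2 ⊢
    calc ‖thetaFactor m c τ‖ * ‖(c : ℂ) + m + τ * I‖ ^ 2
        ≤ C * (1 + |τ|) ^ (2 * m : ℝ) * ((1 + |c + m|) * (1 + |τ|) ^ (1 : ℝ)) ^ 2 := by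
          gcongr
          exact h τ
      _ = C * (1 + |c + m|) ^ 2 * (1 + |τ|) ^ (2 * ((m : ℝ) + 1)) := by
          rw [show 2 * ((m : ℝ) + 1) = 2 * m + 2 by ring, Real.rpow_add h0, Real.rpow_two,
            Real.rpow_one]
          ring

lemma WeightedIntegrable.thetaFactor_mul {a : ℝ} {φ : ℝ → ℂ} (hφ : WeightedIntegrable a φ) (m : ℕ)
    (c : ℝ) : WeightedIntegrable (a - 2 * m) fun τ => thetaFactor m c τ * φ τ := by
  obtain ⟨C, -, h⟩ := norm_thetaFactor_le m c
  exact hφ.mul_of_bound (continuous_thetaFactor m c) h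

lemma logTheta_iterate_lineInverse (c : ℝ) (m : ℕ) {φ : ℝ → ℂ}
    (hφ : WeightedIntegrable (2 * m) φ) :
    logTheta^[m] (lineInverse c φ) = lineInverse (c + m) fun τ => thetaFactor m c τ * φ τ := by
  induction m with
  | zero => simp [thetaFactor]
  | succ m ih =>
    have h1 := hφ.thetaFactor_mul m c
    rw [Function.iterate_succ_apply', ih (hφ.mono (by push_cast; linarith)),
      logTheta_lineInverse _ (h1.mono (by push_cast; linarith))]
    congr 1
    · push_cast; ring
    · funext τ
      rw [thetaFactor, thetaFactor, Finset.prod_range_succ]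
      push_cast
      ring

/-! ### Parseval's identity and Mellin inversion -/

lemma integral_mul_fourier_swap {A φ : ℝ → ℂ} (hA : Integrable A) (hφ : Integrable φ) :
    ∫ t : ℝ, A t * ∫ τ : ℝ, φ τ * cexp (-(τ * I) * t)
      = ∫ τ : ℝ, φ τ * ∫ t : ℝ, A t * cexp (-(τ * I) * t) := by
  have h : Integrable (Function.uncurry fun t τ : ℝ => A t * φ τ * cexp (-(τ * I) * t))
      (volume.prod volume) := by
    refine (hA.mul_prod hφ).mul_bdd (c := 1) ?_ (Filter.Eventually.of_forall fun p => ?_)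
    · exact Continuous.aestronglyMeasurable (by fun_prop)
    · have := norm_cexp_line 0 p.2 p.1
      simp only [ofReal_zero, zero_add, zero_mul, neg_zero, Real.exp_zero] at this
      exact this.le
  simp only [← integral_const_mul]
  calc ∫ t : ℝ, ∫ τ : ℝ, A t * (φ τ * cexp (-(τ * I) * t))
      = ∫ t : ℝ, ∫ τ : ℝ, A t * φ τ * cexp (-(τ * I) * t) := by simp only [mul_assoc]
    _ = ∫ τ : ℝ, ∫ t : ℝ, A t * φ τ * cexp (-(τ * I) * t) := integral_integral_swap h
    _ = _ := by
      refine integral_congr_ae (Filter.Eventually.of_forall fun τ => ?_)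
      beta_reduce
      congr 1
      funext t
      ring

lemma lineInverse_eq (c : ℝ) (φ : ℝ → ℂ) (t : ℝ) : lineInverse c φ t
    = cexp (-(c * t)) * ((2 * Real.pi : ℂ)⁻¹ * ∫ τ : ℝ, φ τ * cexp (-(τ * I) * t)) := by
  rw [lineInverse, mul_left_comm, ← integral_const_mul (cexp (-(c * t)))]
  congr 2
  funext τ
  rw [show -((c : ℂ) + τ * I) * t = -(c * t) + -(τ * I) * t by ring, Complex.exp_add]
  ring

/-- Parseval's identity for the Mellin transform. -/
lemma integral_exp_mul_lineInverse {a : ℝ} {F φ : ℝ → ℂ} (hF : ExpIntegrable a F)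
    (hφ : Integrable φ) :
    ∫ t : ℝ, cexp t * F t * lineInverse (1 - a) φ t
      = (2 * Real.pi : ℂ)⁻¹ * ∫ τ : ℝ, φ τ * lineTransform a F (-τ) := by
  have h := integral_mul_fourier_swap hF hφ
  have e1 : ∀ t : ℝ, cexp t * F t * lineInverse (1 - a) φ t = (2 * Real.pi : ℂ)⁻¹ *
      (F t * cexp (a * t) * ∫ τ : ℝ, φ τ * cexp (-(τ * I) * t)) := by
    intro t
    rw [lineInverse_eq]
    have : cexp (a * t) = cexp t * cexp (-((1 - a : ℝ) * t)) := by
      rw [← Complex.exp_add]; push_cast; ring_nf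
    rw [this]
    ring
  simp only [e1]
  rw [integral_const_mul, h]
  congr 1
  refine integral_congr_ae (Filter.Eventually.of_forall fun τ => ?_)
  simp only [lineTransform]
  congr 1
  refine integral_congr_ae (Filter.Eventually.of_forall fun t => ?_)
  simp only
  rw [mul_assoc, ← Complex.exp_add]
  push_cast
  ring_nf

/-- Split `e^t = e^{at} e^{(1-a)t}`: the first factor makes `F` integrable, the second makes the
inverse transform on `Re s = 1 - a` bounded. -/
lemma integrable_exp_mul_lineInverse {a : ℝ} {F φ : ℝ → ℂ} (hF : ExpIntegrable a F)
    (hφ : Integrable φ) : Integrable fun t : ℝ => cexp t * F t * lineInverse (1 - a) φ t := by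
  have hc : Continuous fun t : ℝ => cexp ((1 - a) * t) * lineInverse (1 - a) φ t :=
    Continuous.mul (by fun_prop) (continuous_lineInverse _ hφ)
  have h := Integrable.mul_bdd (c := (2 * Real.pi)⁻¹ * ∫ τ, ‖φ τ‖) hF hc.aestronglyMeasurable
    (Filter.Eventually.of_forall fun t => ?_)
  · refine h.congr (Filter.Eventually.of_forall fun t => ?_)
    simp only
    have : cexp t = cexp (a * t) * cexp ((1 - a) * t) := by
      rw [← Complex.exp_add]; ring_nf
    rw [this]
    ring
  · rw [norm_mul, Complex.norm_exp]
    have e : ((1 - (a : ℂ)) * (t : ℂ)).re = (1 - a) * t := by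
      rw [← ofReal_one, ← ofReal_sub, ← ofReal_mul, ofReal_re]
    rw [e]
    calc _ ≤ Real.exp ((1 - a) * t) * (Real.exp (-((1 - a) * t)) * ((2 * Real.pi)⁻¹ * ∫ τ, ‖φ τ‖)) := by
          gcongr
          exact norm_lineInverse_le _ _ _
      _ = _ := by rw [← mul_assoc, ← Real.exp_add, add_neg_cancel, Real.exp_zero, one_mul]

lemma lineTransform_eq_fourier (c : ℝ) (F : ℝ → ℂ) (τ : ℝ) :
    lineTransform c F τ = 𝓕 (fun t : ℝ => F t * cexp (c * t)) (-(2 * Real.pi)⁻¹ * τ) := by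
  rw [Real.fourier_real_eq_integral_exp_smul, lineTransform]
  congr 1
  funext t
  rw [smul_eq_mul, mul_left_comm, ← Complex.exp_add]
  have : -2 * Real.pi * t * (-(2 * Real.pi)⁻¹ * τ) = τ * t := by
    have := Real.pi_pos
    field_simp
  rw [this]
  push_cast
  ring_nf

lemma ExpIntegrable.continuous_lineTransform {c : ℝ} {F : ℝ → ℂ} (hF : ExpIntegrable c F) :
    Continuous (lineTransform c F) := by
  have h : Continuous (𝓕 (fun t : ℝ => F t * cexp (c * t))) :=
    VectorFourier.fourierIntegral_continuous Real.continuous_fourierChar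
      (by exact continuous_inner) hF
  have h2 : Continuous fun τ : ℝ => -(2 * Real.pi)⁻¹ * τ := by fun_prop
  simpa only [Function.comp_def, ← lineTransform_eq_fourier] using h.comp h2

lemma lineInverse_eq_fourierInv (c : ℝ) (G : ℝ → ℂ) (t : ℝ) :
    lineInverse c (fun τ => G (-(2 * Real.pi)⁻¹ * τ)) t = cexp (-(c * t)) * 𝓕⁻ G t := by
  have hpi := Real.pi_pos
  rw [lineInverse_eq, Real.fourierInv_eq']
  congr 1
  have := Measure.integral_comp_mul_left
    (fun v : ℝ => cexp (((2 * Real.pi * inner ℝ v t : ℝ) : ℂ) * I) • G v) (-(2 * Real.pi)⁻¹)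
  rw [inv_neg, inv_inv, abs_neg, abs_of_pos (by positivity)] at this
  have e : ∀ τ : ℝ, G (-(2 * Real.pi)⁻¹ * τ) * cexp (-(τ * I) * t)
      = cexp (((2 * Real.pi * inner ℝ (-(2 * Real.pi)⁻¹ * τ) t : ℝ) : ℂ) * I) •
        G (-(2 * Real.pi)⁻¹ * τ) := by
    intro τ
    have e2 : 2 * Real.pi * inner ℝ (-(2 * Real.pi)⁻¹ * τ) t = -(τ * t) := by
      have e3 : inner ℝ (-(2 * Real.pi)⁻¹ * τ) t = t * (-(2 * Real.pi)⁻¹ * τ) := rfl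
      rw [e3]
      field_simp
    rw [e2, smul_eq_mul, mul_comm]
    push_cast
    ring_nf
  simp only [e]
  rw [this]
  simp only [real_smul]
  push_cast
  rw [inv_mul_cancel_left₀]
  exact_mod_cast (by positivity : (2 * Real.pi : ℝ) ≠ 0)

lemma lineInverse_lineTransform {c : ℝ} {F : ℝ → ℂ} (hc : Continuous F) (hF : ExpIntegrable c F)
    (hT : Integrable (lineTransform c F)) : lineInverse c (lineTransform c F) = F := by
  have hpi := Real.pi_pos
  set G : ℝ → ℂ := fun t : ℝ => F t * cexp (c * t) with hG
  have hGc : Continuous G := by fun_prop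
  have e1 : lineTransform c F = fun τ => 𝓕 G (-(2 * Real.pi)⁻¹ * τ) :=
    funext fun τ => lineTransform_eq_fourier c F τ
  have hGT : Integrable (𝓕 G) := by
    rw [e1] at hT
    exact (integrable_comp_mul_left_iff _ (by simp [hpi.ne'])).1 hT
  funext t
  rw [e1, lineInverse_eq_fourierInv, hGc.fourierInv_fourier_eq hF hGT, hG]
  simp only
  rw [mul_left_comm, ← Complex.exp_add]
  simp

lemma HasCompactSupport.expIntegrable {ψ : ℝ → ℂ} (hs : HasCompactSupport ψ) (hψ : Continuous ψ)
    (c : ℝ) : ExpIntegrable c ψ :=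
  Continuous.integrable_of_hasCompactSupport (by fun_prop) hs.mul_right

lemma HasCompactSupport.weightedIntegrable_lineTransform {ψ : ℝ → ℂ} (hs : HasCompactSupport ψ)
    (hψ : ContDiff ℝ ∞ ψ) (a c : ℝ) : WeightedIntegrable a (lineTransform c ψ) := by
  have hpi := Real.pi_pos
  suffices h : ∀ n : ℕ, WeightedIntegrable n (lineTransform c ψ) from
    (h ⌈a⌉₊).mono (Nat.le_ceil a)
  intro n
  set G : ℝ → ℂ := fun t : ℝ => ψ t * cexp (c * t) with hG
  have hexp : ContDiff ℝ ∞ fun t : ℝ => cexp (c * t) :=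
    ((contDiff_const.mul ofRealCLM.contDiff)).cexp
  have hGs : HasCompactSupport G := hs.mul_right
  -- On any line the weighted test function is a Schwartz function, so its transform decays faster
  -- than every power.
  set S := hGs.toSchwartzMap (hψ.mul hexp)
  have hS : (S : ℝ → ℂ) = G := rfl
  have hint : ∀ k : ℕ, Integrable fun τ : ℝ => |τ| ^ k * ‖lineTransform c ψ τ‖ := by
    intro k
    have h1 := (𝓕 S).integrable_pow_mul volume k
    rw [SchwartzMap.fourier_coe, hS] at h1
    have h2 := (integrable_comp_mul_left_iff _ (show -(2 * Real.pi)⁻¹ ≠ 0 by simp [hpi.ne'])).2 h1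
    refine (h2.const_mul ((2 * Real.pi) ^ k)).congr (Filter.Eventually.of_forall fun τ => ?_)
    simp only
    rw [← lineTransform_eq_fourier, ← mul_assoc, Real.norm_eq_abs, ← mul_pow, abs_mul, abs_neg,
      abs_of_pos (by positivity : 0 < (2 * Real.pi)⁻¹)]
    congr 2
    field_simp
  have hE := hs.expIntegrable hψ.continuous c
  have hb := ((hint 0).add (hint n)).const_mul ((2 : ℝ) ^ n)
  refine Integrable.mono' hb ?_ (Filter.Eventually.of_forall fun τ => ?_)
  · exact ((continuous_weight _).mul hE.continuous_lineTransform).aestronglyMeasurable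
  · rw [norm_mul, norm_real, Real.norm_of_nonneg (by positivity), Real.rpow_natCast]
    simp only [Pi.add_apply, pow_zero]
    have h3 : (1 + |τ|) ^ n ≤ 2 ^ n * (1 + |τ| ^ n) := by
      rcases le_total |τ| 1 with h | h
      · calc (1 + |τ|) ^ n ≤ 2 ^ n := by gcongr; linarith
          _ ≤ _ := le_mul_of_one_le_right (by positivity) (by simp)
      · calc (1 + |τ|) ^ n ≤ (2 * |τ|) ^ n := by gcongr; linarith
          _ = 2 ^ n * |τ| ^ n := mul_pow _ _ _
          _ ≤ _ := by gcongr; simp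
    calc _ ≤ 2 ^ n * (1 + |τ| ^ n) * ‖lineTransform c ψ τ‖ := by gcongr
      _ = _ := by ring

/-- Mellin inversion almost everywhere. -/
lemma ae_eq_lineInverse_lineTransform {c : ℝ} {F : ℝ → ℂ} (hF : ExpIntegrable c F)
    (hT : Integrable (lineTransform c F)) : F =ᵐ[volume] lineInverse c (lineTransform c F) := by
  have hFloc : LocallyIntegrable F := by
    have h1 : Continuous fun t : ℝ => cexp (-(c * t)) := by fun_prop
    have h2 : LocallyIntegrable fun t : ℝ => F t * cexp (c * t) := Integrable.locallyIntegrable hF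
    have := h2.locallyIntegrableOn univ |>.mul_continuousOn h1.continuousOn isOpen_univ.isLocallyClosed
    rw [locallyIntegrableOn_univ] at this
    refine this.congr (Filter.Eventually.of_forall fun t => ?_)
    simp only
    rw [mul_assoc, ← Complex.exp_add]
    simp
  refine ae_eq_of_integral_contDiff_smul_eq hFloc
    (continuous_lineInverse c hT).locallyIntegrable fun g hg hgs => ?_
  -- The factor `e^{-t}` cancels the weight `e^t` in Parseval's identity.
  set ψ : ℝ → ℂ := fun t => cexp (-t) * (g t : ℂ) with hψdef
  have hexp : ContDiff ℝ ∞ fun t : ℝ => cexp (-t) := ofRealCLM.contDiff.neg.cexp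
  have hψ : ContDiff ℝ ∞ ψ := hexp.mul (ofRealCLM.contDiff.comp hg)
  have hgs' : HasCompactSupport fun t => (g t : ℂ) := hgs.comp_left (g := ofReal) ofReal_zero
  have hψs : HasCompactSupport ψ := hgs'.mul_left
  have hψE := hψs.expIntegrable hψ.continuous (1 - c)
  have hψT : Integrable (lineTransform (1 - c) ψ) :=
    weightedIntegrable_zero.1 (hψs.weightedIntegrable_lineTransform hψ 0 (1 - c))
  have hinv := lineInverse_lineTransform hψ.continuous hψE hψT
  have key : ∀ t : ℝ, cexp t * ψ t = g t := by
    intro t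
    rw [hψdef]
    simp only
    rw [← mul_assoc, ← Complex.exp_add]
    simp
  -- Parseval is applied twice with the roles exchanged: once inverting `ψ` on `Re s = 1 - c`, once
  -- inverting the transform of `F` on `Re s = c`. The Mellin sides agree after `τ ↦ -τ`.
  have h1 := integral_exp_mul_lineInverse hF hψT
  rw [hinv] at h1
  have h2 := integral_exp_mul_lineInverse hψE hT
  rw [sub_sub_cancel] at h2
  have e1 : ∀ t : ℝ, g t • F t = cexp t * F t * ψ t := by
    intro t
    rw [real_smul, ← key t]; ring
  have e2 : ∀ t : ℝ, g t • lineInverse c (lineTransform c F) t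
      = cexp t * ψ t * lineInverse c (lineTransform c F) t := by
    intro t
    rw [real_smul, key t]
  simp only [e1, e2]
  rw [h1, h2]
  congr 1
  rw [← integral_neg_eq_self]
  congr 1
  funext τ
  rw [neg_neg, mul_comm]

/-! ### The left-sided integral as a Mellin multiplier -/

lemma integrable_logKernel_sub_mul_cexp {β : ℝ} (hβ : 0 < β) (hβ1 : β ≤ 1) {z : ℂ} (hz : z.re < 1)
    (t : ℝ) : Integrable fun s : ℝ => (logKernel β (t - s) : ℂ) * cexp (-z * s) := by
  have h := ((integrable_logKernel_mul_cexp hβ hβ1 hz).comp_sub_left t).const_mul (cexp (-z * t))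
  refine h.congr (Filter.Eventually.of_forall fun s => ?_)
  simp only
  rw [mul_left_comm, ← Complex.exp_add]
  push_cast
  ring_nf

lemma integral_logKernel_sub_mul_cexp {β : ℝ} (hβ : 0 < β) (hβ1 : β ≤ 1) {z : ℂ} (hz : z.re < 1)
    (t : ℝ) : ∫ s : ℝ, (logKernel β (t - s) : ℂ) * cexp (-z * s) = symbol β z ^ 2 * cexp (-z * t) := by
  rw [← integral_logKernel_mul_cexp hβ hβ1 hz,
    ← integral_sub_left_eq_self (fun r : ℝ => (logKernel β r : ℂ) * cexp (z * r)) volume t,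
    ← integral_mul_const]
  congr 1
  funext s
  rw [mul_assoc, ← Complex.exp_add]
  push_cast
  ring_nf

lemma integrable_logKernel_mul_lineInverse {β : ℝ} (hβ : 0 < β) (hβ1 : β ≤ 1) {c : ℝ} (hc : c < 1)
    {φ : ℝ → ℂ} (hφ : Integrable φ) (t : ℝ) :
    Integrable fun s : ℝ => (logKernel β (t - s) : ℂ) * lineInverse c φ s := by
  have h := integrable_logKernel_sub_mul_cexp hβ hβ1 (z := c) (by simpa) t
  have hcont : Continuous fun s : ℝ => cexp (c * s) * lineInverse c φ s :=
    Continuous.mul (by fun_prop) (continuous_lineInverse c hφ)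
  have h2 := h.mul_bdd (c := (2 * Real.pi)⁻¹ * ∫ τ, ‖φ τ‖) hcont.aestronglyMeasurable
    (Filter.Eventually.of_forall fun s => ?_)
  · refine h2.congr (Filter.Eventually.of_forall fun s => ?_)
    simp only
    rw [mul_assoc, ← mul_assoc (cexp _), ← Complex.exp_add]
    simp
  · rw [norm_mul, Complex.norm_exp]
    have e : ((c : ℂ) * s).re = c * s := by rw [← ofReal_mul, ofReal_re]
    rw [e]
    calc _ ≤ Real.exp (c * s) * (Real.exp (-(c * s)) * ((2 * Real.pi)⁻¹ * ∫ τ, ‖φ τ‖)) := by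
          gcongr
          exact norm_lineInverse_le _ _ _
      _ = _ := by rw [← mul_assoc, ← Real.exp_add, add_neg_cancel, Real.exp_zero, one_mul]

/-- The action of the left-sided Laguerre fractional integral on the Mellin side. -/
lemma integral_logKernel_mul_lineInverse {β : ℝ} (hβ : 0 < β) (hβ1 : β ≤ 1) {c : ℝ} (hc : c < 1)
    {φ : ℝ → ℂ} (hφ : Integrable φ) (t : ℝ) :
    cexp (β * t) * ∫ s : ℝ, (logKernel β (t - s) : ℂ) * lineInverse c φ s
      = lineInverse (c - β) (fun τ => symbol β (c + τ * I) ^ 2 * φ τ) t := by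
  have h := integrable_logKernel_sub_mul_cexp hβ hβ1 (z := c) (by simpa) t
  have hsw := integral_mul_fourier_swap h hφ
  have e1 : ∀ s : ℝ, (logKernel β (t - s) : ℂ) * lineInverse c φ s = (2 * Real.pi : ℂ)⁻¹ *
      ((logKernel β (t - s) : ℂ) * cexp (-c * s) * ∫ τ : ℝ, φ τ * cexp (-(τ * I) * s)) := by
    intro s
    rw [lineInverse_eq, neg_mul]
    ring
  have e2 : ∀ τ : ℝ, ∫ s : ℝ, (logKernel β (t - s) : ℂ) * cexp (-c * s) * cexp (-(τ * I) * s)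
      = symbol β (c + τ * I) ^ 2 * cexp (-(c + τ * I) * t) := by
    intro τ
    rw [← integral_logKernel_sub_mul_cexp hβ hβ1 (z := c + τ * I) (by simpa) t]
    congr 1
    funext s
    rw [mul_assoc, ← Complex.exp_add]
    ring_nf
  simp only [e1]
  rw [integral_const_mul, hsw, lineInverse, mul_left_comm, ← integral_const_mul (cexp (β * t))]
  congr 2
  funext τ
  rw [e2]
  push_cast
  rw [show -((c : ℂ) - β + τ * I) * t = β * t + -(c + τ * I) * t by ring, Complex.exp_add (β * t)]
  ring

/-- The left-sided Laguerre fractional integral in the coordinate `log x`. -/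
noncomputable def logLeft (β : ℝ) (G : ℝ → ℂ) (t : ℝ) : ℂ :=
  cexp (β * t) * ∫ s : ℝ, (logKernel β (t - s) : ℂ) * G s

/-- The right-sided Laguerre fractional integral in the coordinate `log x`. -/
noncomputable def logRight (β : ℝ) (F : ℝ → ℂ) (t : ℝ) : ℂ :=
  cexp (-t) * ∫ s : ℝ, (logKernel β (s - t) : ℂ) * (cexp ((β + 1) * s) * F s)

/-- The factor by which the left-sided Laguerre derivative of order `m - β` multiplies `x^{-s}`,
`s = c + iτ`. -/
noncomputable def laguerreMultiplier (β : ℝ) (m : ℕ) (c τ : ℝ) : ℂ :=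
  thetaFactor m (c - β) τ * symbol β (c + τ * I) ^ 2

lemma WeightedIntegrable.symbol_sq_mul {β : ℝ} (hβ : 0 < β) (hβ1 : β ≤ 1) {c : ℝ} (hc : c < 1)
    {a : ℝ} {φ : ℝ → ℂ} (hφ : WeightedIntegrable a φ) :
    WeightedIntegrable (a + 2 * β) fun τ => symbol β (c + τ * I) ^ 2 * φ τ := by
  obtain ⟨C, hC, h⟩ := symbol_vertical_bound hβ hβ1 hc
  have := hφ.mul_of_bound (P := fun τ : ℝ => symbol β (c + τ * I) ^ 2) (b := -2 * β) (C := C ^ 2)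
    ((continuous_symbol_vertical hβ hβ1 hc).pow 2) fun τ => by
      have h0 : 0 ≤ 1 + |τ| := by positivity
      rw [norm_pow]
      calc ‖symbol β (c + τ * I)‖ ^ 2 ≤ (C * (1 + |τ|) ^ (-β)) ^ 2 := by gcongr; exact h τ
        _ = C ^ 2 * (1 + |τ|) ^ (-2 * β) := by
          rw [mul_pow, ← Real.rpow_natCast ((1 + |τ|) ^ (-β)), ← Real.rpow_mul h0]
          push_cast
          ring_nf
  rwa [show a - -2 * β = a + 2 * β by ring] at this

/-- The weights balance exactly: `symbol ^ 2` gains `2β`, the factor of `θ^m` costs `2m`, and `2(m -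
β) + 2β - 2m = 0`. -/
lemma WeightedIntegrable.integrable_laguerreMultiplier_mul {β : ℝ} (hβ : 0 < β) (hβ1 : β ≤ 1)
    {c : ℝ} (hc : c < 1) {m : ℕ} {φ : ℝ → ℂ} (hφ : WeightedIntegrable (2 * (m - β)) φ) :
    Integrable fun τ => laguerreMultiplier β m c τ * φ τ := by
  have h := (hφ.symbol_sq_mul hβ hβ1 hc).thetaFactor_mul m (c - β)
  have := h.integrable (by linarith)
  simpa only [laguerreMultiplier, mul_assoc] using this

lemma WeightedIntegrable.integrable_laguerreMultiplier_neg_mul {β : ℝ} (hβ : 0 < β) (hβ1 : β ≤ 1)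
    {c : ℝ} (hc : c < 1) {m : ℕ} {φ : ℝ → ℂ} (hφ : WeightedIntegrable (2 * (m - β)) φ) :
    Integrable fun τ => laguerreMultiplier β m c (-τ) * φ τ := by
  have h := (hφ.comp_neg.integrable_laguerreMultiplier_mul hβ hβ1 hc).comp_neg
  simpa using h

lemma logLeft_lineInverse {β : ℝ} (hβ : 0 < β) (hβ1 : β ≤ 1) {c : ℝ} (hc : c < 1)
    {φ : ℝ → ℂ} (hφ : Integrable φ) : logLeft β (lineInverse c φ)
      = lineInverse (c - β) fun τ => symbol β (c + τ * I) ^ 2 * φ τ :=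
  funext fun t => integral_logKernel_mul_lineInverse hβ hβ1 hc hφ t

lemma contDiff_logLeft_lineInverse {β : ℝ} (hβ : 0 < β) (hβ1 : β ≤ 1) {c : ℝ} (hc : c < 1) {m : ℕ}
    (hm : β ≤ m) {φ : ℝ → ℂ} (hφ : WeightedIntegrable (2 * (m - β)) φ) :
    ContDiff ℝ ((2 * m : ℕ) : WithTop ℕ∞) (logLeft β (lineInverse c φ)) := by
  rw [logLeft_lineInverse hβ hβ1 hc (hφ.integrable (by linarith))]
  refine contDiff_lineInverse _ _ ((hφ.symbol_sq_mul hβ hβ1 hc).mono ?_)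
  push_cast
  linarith

lemma logTheta_iterate_logLeft_lineInverse {β : ℝ} (hβ : 0 < β) (hβ1 : β ≤ 1) {c : ℝ} (hc : c < 1)
    {m : ℕ} (hm : β ≤ m) {φ : ℝ → ℂ} (hφ : WeightedIntegrable (2 * (m - β)) φ) :
    logTheta^[m] (logLeft β (lineInverse c φ))
      = lineInverse (c - β + m) fun τ => laguerreMultiplier β m c τ * φ τ := by
  rw [logLeft_lineInverse hβ hβ1 hc (hφ.integrable (by linarith)),
    logTheta_iterate_lineInverse _ _ ((hφ.symbol_sq_mul hβ hβ1 hc).mono (by linarith))]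
  simp only [laguerreMultiplier, mul_assoc]

/-! ### Commutation with `θ^m` on test functions, and adjointness of the multipliers -/

/-- The functional equation iterated at `z, z + 1, …, z + m - 1`; the hypothesis keeps all these
points in `Re < 0`. -/
lemma symbol_add_natCast {β : ℝ} (hβ : 0 < β) (hβ1 : β ≤ 1) (m : ℕ) {z : ℂ} (hz : z.re + m ≤ 0) :
    symbol β (z + m) * ∏ j ∈ Finset.range m, (z + j)
      = symbol β z * ∏ j ∈ Finset.range m, (z - β + j) := by
  induction m with
  | zero => simp
  | succ m ih =>
    push_cast at hz
    have h := symbol_functional_equation hβ hβ1 (z := z + m) (by simp; linarith)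
    rw [Finset.prod_range_succ, Finset.prod_range_succ, ← mul_assoc, ← mul_assoc,
      ← ih (by linarith)]
    push_cast
    rw [← add_assoc]
    linear_combination (∏ j ∈ Finset.range m, (z + j)) * h

/-- On test functions the left-sided fractional integral commutes with `θ^m`; the right side is the
Mellin representation of `θ^m` of the fractional integral on the line `Re s = c`. -/
lemma logLeft_logTheta_iterate {β : ℝ} (hβ : 0 < β) (hβ1 : β ≤ 1) {c : ℝ} (hc : c < 1)
    {m : ℕ} (hm : β ≤ m) {ψ : ℝ → ℂ} (hs : HasCompactSupport ψ) (hψ : ContDiff ℝ ∞ ψ) :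
    logLeft β (logTheta^[m] ψ)
      = lineInverse (c - β + m) fun τ => laguerreMultiplier β m c τ * lineTransform c ψ τ := by
  have hinv : ∀ y, lineInverse y (lineTransform y ψ) = ψ := fun y =>
    lineInverse_lineTransform hψ.continuous (hs.expIntegrable hψ.continuous y)
      (weightedIntegrable_zero.1 (hs.weightedIntegrable_lineTransform hψ 0 y))
  have hw : ∀ a y, WeightedIntegrable a (lineTransform y ψ) :=
    fun a y => hs.weightedIntegrable_lineTransform hψ a y
  rw [← logTheta_iterate_logLeft_lineInverse hβ hβ1 hc hm (hw _ c), hinv c]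
  -- A test function has a transform on every line, so both sides may be computed on `Re s = -m`.
  -- There `θ^m` leads to `Re s = 0`, still left of `1`, and the iterated functional equation
  -- applies.
  set y : ℝ := -m with hy
  have hm0 : (0 : ℝ) ≤ m := Nat.cast_nonneg m
  have h1 := logTheta_iterate_lineInverse y m (hw (2 * m) y)
  rw [hinv y] at h1
  have h2 := logTheta_iterate_logLeft_lineInverse hβ hβ1 (c := y) (by linarith) hm (hw _ y)
  rw [hinv y] at h2
  have hi : Integrable fun τ => thetaFactor m y τ * lineTransform y ψ τ :=
    ((hw (2 * m) y).thetaFactor_mul m y).integrable (by linarith)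
  rw [h2, h1, logLeft_lineInverse hβ hβ1 (by linarith) hi]
  congr 1
  · ring
  · funext τ
    have h3 := symbol_add_natCast hβ hβ1 m (z := y + τ * I) (by simp [hy])
    have e1 : thetaFactor m y τ = (∏ j ∈ Finset.range m, ((y : ℂ) + τ * I + j)) ^ 2 := by
      rw [thetaFactor, ← Finset.prod_pow]
      refine Finset.prod_congr rfl fun j _ => ?_
      ring
    have e2 : thetaFactor m (y - β) τ
        = (∏ j ∈ Finset.range m, ((y : ℂ) + τ * I - β + j)) ^ 2 := by
      rw [thetaFactor, ← Finset.prod_pow]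
      refine Finset.prod_congr rfl fun j _ => ?_
      push_cast
      ring
    rw [laguerreMultiplier, e1, e2]
    push_cast
    rw [show (y : ℂ) + m + τ * I = y + τ * I + m by ring]
    rw [← mul_assoc, ← mul_pow, h3]
    ring

/-- Adjointness of the two Laguerre fractional derivatives on the Mellin side. -/
lemma integral_laguerreMultiplier_adjoint {β : ℝ} {m : ℕ} {c c' : ℝ} (hcc : c + c' = 1 + β - m)
    {F G : ℝ → ℂ} (hF : ExpIntegrable c' F) (hG : ExpIntegrable c G)
    (hFM : Integrable fun τ => laguerreMultiplier β m c (-τ) * lineTransform c' F τ)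
    (hGM : Integrable fun τ => laguerreMultiplier β m c τ * lineTransform c G τ) :
    ∫ t : ℝ, cexp t * F t *
        lineInverse (c - β + m) (fun τ => laguerreMultiplier β m c τ * lineTransform c G τ) t
      = ∫ t : ℝ, cexp t * G t *
        lineInverse (c' - β + m) (fun τ => laguerreMultiplier β m c (-τ) * lineTransform c' F τ) t := by
  have h1 := integral_exp_mul_lineInverse hF hGM
  have h2 := integral_exp_mul_lineInverse hG hFM
  rw [show 1 - c' = c - β + m by linarith] at h1
  rw [show 1 - c = c' - β + m by linarith] at h2
  rw [h1, h2]
  congr 1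
  rw [← integral_neg_eq_self]
  congr 1
  funext τ
  rw [neg_neg]
  ring

/-! ### Continuity and duality of the right-sided integral -/

/-- Convergence is known only for each `t` separately, so a dominating function has to be made. Near
`t₀` the variable is translated and the integrable kernel dominates; far to the right, the decrease
of `logKernel β r / r` bounds the integrand by a multiple of the one at `t₀ + 1`. -/
lemma continuous_integral_logKernel_sub {β : ℝ} (hβ : 0 < β) (hβ1 : β ≤ 1) {a : ℝ → ℂ}
    (ha : Continuous a) (hi : ∀ t : ℝ, Integrable fun s : ℝ => (logKernel β (s - t) : ℂ) * a s) :
    Continuous fun t : ℝ => ∫ s : ℝ, (logKernel β (s - t) : ℂ) * a s := by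
  refine continuous_iff_continuousAt.2 fun t₀ => ?_
  -- A continuous cutoff, equal to `1` up to `t₀ + 2` and to `0` from `t₀ + 3` on. The far part then
  -- lives on `s > t₀ + 2`, away from the singularity of the kernel.
  set η : ℝ → ℝ := fun s => max 0 (min 1 (t₀ + 3 - s)) with hη
  have hηc : Continuous η := by fun_prop
  have hη0 : ∀ s, 0 ≤ η s := fun s => le_max_left _ _
  have hη1 : ∀ s, η s ≤ 1 := fun s => max_le zero_le_one (min_le_left _ _)
  set a₁ : ℝ → ℂ := fun s => (η s : ℂ) * a s with ha₁
  set a₂ : ℝ → ℂ := fun s => ((1 - η s : ℝ) : ℂ) * a s with ha₂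
  have ha₁c : Continuous a₁ := by fun_prop
  have ha₂c : Continuous a₂ := by fun_prop
  have hmul : ∀ ξ : ℝ → ℝ, Continuous ξ → (∀ s, 0 ≤ ξ s) → (∀ s, ξ s ≤ 1) → ∀ t : ℝ,
      Integrable fun s : ℝ => (logKernel β (s - t) : ℂ) * ((ξ s : ℂ) * a s) := by
    intro ξ hξ h0 h1 t
    have := (hi t).mul_bdd (c := 1) (g := fun s => (ξ s : ℂ)) (by fun_prop)
      (Filter.Eventually.of_forall fun s => by
        rw [norm_real, Real.norm_of_nonneg (h0 s)]; exact h1 s)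
    refine this.congr (Filter.Eventually.of_forall fun s => ?_)
    simp only
    ring
  have hi₁ := hmul η hηc hη0 hη1
  have hi₂ := hmul (fun s => 1 - η s) (by fun_prop) (fun s => by linarith [hη1 s])
    (fun s => by linarith [hη0 s])
  have hsplit : (fun t : ℝ => ∫ s : ℝ, (logKernel β (s - t) : ℂ) * a s)
      = fun t : ℝ => (∫ r : ℝ, (logKernel β r : ℂ) * a₁ (r + t)) +
        ∫ s : ℝ, (logKernel β (s - t) : ℂ) * a₂ s := by
    funext t
    have e : ∫ r : ℝ, (logKernel β r : ℂ) * a₁ (r + t) = ∫ s : ℝ, (logKernel β (s - t) : ℂ) * a₁ s := by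
      rw [← integral_sub_right_eq_self (fun r : ℝ => (logKernel β r : ℂ) * a₁ (r + t)) t]
      simp
    rw [e, ← integral_add (hi₁ t) (hi₂ t)]
    congr 1
    funext s
    push_cast
    ring
  rw [hsplit]
  have hkm := measurable_logKernel hβ hβ1
  have hki : Integrable (logKernel β) := by
    simpa using integrable_logKernel_mul_exp hβ hβ1 (c := 0) one_pos
  obtain ⟨C, hC⟩ := (isCompact_Icc (a := t₀ - 1) (b := t₀ + 3)).exists_bound_of_continuousOn
    ha₁c.continuousOn
  refine ContinuousAt.add ?_ ?_
  · refine continuousAt_of_dominated (bound := fun r => logKernel β r * max C 0) ?_ ?_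
      (hki.mul_const _) ?_
    · exact Filter.Eventually.of_forall fun t =>
        (hkm.complex_ofReal.mul (by fun_prop)).aestronglyMeasurable
    · filter_upwards [Ioo_mem_nhds (show t₀ - 1 < t₀ by linarith) (show t₀ < t₀ + 1 by linarith)]
        with t ht
      refine Filter.Eventually.of_forall fun r => ?_
      rw [norm_mul, norm_real, Real.norm_of_nonneg (logKernel_nonneg hβ r)]
      rcases le_or_gt r 0 with hr | hr
      · rw [logKernel_of_nonpos β hr]; simp
      · refine mul_le_mul_of_nonneg_left ?_ (logKernel_nonneg hβ r)
        rcases le_or_gt (r + t) (t₀ + 3) with h | h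
        · exact (hC _ ⟨by linarith [ht.1], h⟩).trans (le_max_left _ _)
        · have : η (r + t) = 0 := max_eq_left ((min_le_right _ _).trans (by linarith))
          simp [ha₁, this]
    · exact Filter.Eventually.of_forall fun r => by fun_prop
  · refine continuousAt_of_dominated
      (bound := fun s => 3 * ‖(logKernel β (s - (t₀ + 1)) : ℂ) * a s‖) ?_ ?_
      ((hi (t₀ + 1)).norm.const_mul 3) ?_
    · exact Filter.Eventually.of_forall fun t => (hi₂ t).aestronglyMeasurable
    · filter_upwards [Ioo_mem_nhds (show t₀ - 1 < t₀ by linarith) (show t₀ < t₀ + 1 by linarith)]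
        with t ht
      refine Filter.Eventually.of_forall fun s => ?_
      rcases le_or_gt s (t₀ + 2) with h | h
      · have : η s = 1 := by
          rw [hη]
          simp only
          rw [min_eq_left (by linarith)]
          simp
        simp only [ha₂, this]
        simp
        positivity
      · rw [norm_mul, norm_mul (logKernel β (s - (t₀ + 1)) : ℂ) (a s), norm_real, norm_real, Real.norm_of_nonneg (logKernel_nonneg hβ _),
          Real.norm_of_nonneg (logKernel_nonneg hβ _), ← mul_assoc]
        have h1 : 0 < s - (t₀ + 1) := by linarith
        have h2 := logKernel_le_div_mul hβ hβ1 h1 (show s - (t₀ + 1) ≤ s - t by linarith [ht.2])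
        -- For `t > t₀ - 1` the ratio is below `(s - t₀ + 1)/(s - t₀ - 1)`, which equals `3` at `s =
        -- t₀ + 2` and decreases in `s`.
        have h3 : (s - t) / (s - (t₀ + 1)) ≤ 3 := by
          rw [div_le_iff₀ h1]; linarith [ht.1]
        have h4 := logKernel_nonneg hβ (s - (t₀ + 1))
        have h5 : ‖a₂ s‖ ≤ ‖a s‖ := by
          simp only [ha₂]
          rw [norm_mul, norm_real, Real.norm_of_nonneg (by linarith [hη1 s])]
          exact mul_le_of_le_one_left (norm_nonneg _) (by linarith [hη0 s])
        have h6 : logKernel β (s - t) ≤ 3 * logKernel β (s - (t₀ + 1)) := h2.trans (by gcongr)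
        gcongr
    · refine Filter.Eventually.of_forall fun s => ?_
      rcases le_or_gt s (t₀ + 1) with h | h
      · have : η s = 1 := by
          rw [hη]
          simp only
          rw [min_eq_left (by linarith)]
          simp
        simp only [ha₂, this]
        simp only [sub_self, ofReal_zero, zero_mul, mul_zero]
        exact continuousAt_const
      · refine ContinuousAt.mul ?_ continuousAt_const
        refine continuous_ofReal.continuousAt.comp ?_
        exact ContinuousAt.comp (f := fun t => s - t)
          (continuousAt_logKernel hβ hβ1 (by linarith)) (by fun_prop)

/-- The two Laguerre fractional integrals are adjoint to each other. -/
lemma integral_logRight_mul {β : ℝ} (hβ : 0 < β) (hβ1 : β ≤ 1) {F N : ℝ → ℂ}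
    (hF : Continuous F) (hi : ∀ t : ℝ, Integrable fun s : ℝ =>
      (logKernel β (s - t) : ℂ) * (cexp ((β + 1) * s) * F s))
    (hN : Continuous N) (hNs : HasCompactSupport N) :
    ∫ t : ℝ, cexp t * logRight β F t * N t = ∫ s : ℝ, cexp s * F s * logLeft β N s := by
  set a : ℝ → ℂ := fun s => cexp ((β + 1) * s) * F s with ha
  have hac : Continuous a := by fun_prop
  have hkm := measurable_logKernel hβ hβ1
  have hnorm : ∀ t : ℝ, Integrable fun s : ℝ => (logKernel β (s - t) : ℂ) * ((‖a s‖ : ℝ) : ℂ) := by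
    intro t
    refine ((hi t).norm.ofReal (𝕜 := ℂ)).congr (Filter.Eventually.of_forall fun s => ?_)
    simp only [coe_algebraMap, norm_mul, norm_real, Real.norm_of_nonneg (logKernel_nonneg hβ _)]
    simp [ha]
  -- Fubini needs the integral of the absolute values to be integrable against `N`; applied to
  -- `‖a‖`, the continuity lemma makes it continuous in `t`, and `N` has compact support.
  have hcont := continuous_integral_logKernel_sub hβ hβ1 (a := fun s => ((‖a s‖ : ℝ) : ℂ))
    (by fun_prop) hnorm
  have hprod : Integrable (Function.uncurry fun t s : ℝ => N t * ((logKernel β (s - t) : ℂ) * a s))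
      (volume.prod volume) := by
    rw [integrable_prod_iff]
    · refine ⟨Filter.Eventually.of_forall fun t => (hi t).const_mul (N t), ?_⟩
      have e : ∀ t : ℝ, ∫ s : ℝ, ‖N t * ((logKernel β (s - t) : ℂ) * a s)‖
          = ‖N t‖ * ‖∫ s : ℝ, (logKernel β (s - t) : ℂ) * ((‖a s‖ : ℝ) : ℂ)‖ := by
        intro t
        have e1 : ∫ s : ℝ, (logKernel β (s - t) : ℂ) * ((‖a s‖ : ℝ) : ℂ)
            = ((∫ s : ℝ, logKernel β (s - t) * ‖a s‖ : ℝ) : ℂ) := by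
          rw [← integral_complex_ofReal]
          push_cast
          rfl
        rw [e1, norm_real, Real.norm_of_nonneg (integral_nonneg fun s =>
          mul_nonneg (logKernel_nonneg hβ _) (norm_nonneg _)), ← integral_const_mul]
        congr 1
        funext s
        rw [norm_mul, norm_mul, norm_real, Real.norm_of_nonneg (logKernel_nonneg hβ _)]
      simp only [Function.uncurry_apply_pair, e]
      exact Continuous.integrable_of_hasCompactSupport (hN.norm.mul hcont.norm) hNs.norm.mul_right
    · refine AEStronglyMeasurable.mul ?_ (AEStronglyMeasurable.mul ?_ ?_)
      · exact Continuous.aestronglyMeasurable (by fun_prop)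
      · exact ((hkm.comp (measurable_snd.sub measurable_fst)).complex_ofReal).aestronglyMeasurable
      · exact Continuous.aestronglyMeasurable (by fun_prop)
  have hsw := integral_integral_swap hprod
  calc ∫ t : ℝ, cexp t * logRight β F t * N t
      = ∫ t : ℝ, ∫ s : ℝ, N t * ((logKernel β (s - t) : ℂ) * a s) := by
        congr 1
        funext t
        rw [integral_const_mul, logRight, ← mul_assoc, ← Complex.exp_add, add_neg_cancel,
          Complex.exp_zero, one_mul, mul_comm]
    _ = ∫ s : ℝ, ∫ t : ℝ, N t * ((logKernel β (s - t) : ℂ) * a s) := hsw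
    _ = _ := by
        congr 1
        funext s
        rw [logLeft, ← mul_assoc, ← integral_const_mul]
        congr 1
        funext t
        simp only [ha]
        rw [show ((β : ℂ) + 1) * s = s + β * s by ring, Complex.exp_add]
        ring

/-! ### Calculus of `θ` in the coordinate `log x` -/

lemma contDiff_cexp_neg_ofReal {n : WithTop ℕ∞} : ContDiff ℝ n fun t : ℝ => cexp (-t) :=
  ofRealCLM.contDiff.neg.cexp

lemma contDiff_logTheta {n : WithTop ℕ∞} {W : ℝ → ℂ} (hW : ContDiff ℝ (n + 2) W) :
    ContDiff ℝ n (logTheta W) := by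
  rw [← one_add_one_eq_two, ← add_assoc] at hW
  exact contDiff_cexp_neg_ofReal.mul hW.deriv'.deriv'

lemma contDiff_logTheta_iterate {n m : ℕ} {W : ℝ → ℂ}
    (hW : ContDiff ℝ ((n + 2 * m : ℕ) : WithTop ℕ∞) W) : ContDiff ℝ n (logTheta^[m] W) := by
  induction m generalizing n with
  | zero => simpa using hW
  | succ m ih =>
    rw [Function.iterate_succ_apply']
    refine contDiff_logTheta ?_
    have := ih (n := n + 2) (by convert hW using 2; ring)
    exact_mod_cast this

lemma contDiff_infty_logTheta {W : ℝ → ℂ} (hW : ContDiff ℝ ∞ W) : ContDiff ℝ ∞ (logTheta W) :=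
  contDiff_logTheta (by exact hW)

lemma contDiff_infty_logTheta_iterate {W : ℝ → ℂ} (hW : ContDiff ℝ ∞ W) (m : ℕ) :
    ContDiff ℝ ∞ (logTheta^[m] W) := by
  induction m with
  | zero => exact hW
  | succ m ih =>
    rw [Function.iterate_succ_apply']
    exact contDiff_infty_logTheta ih

lemma HasCompactSupport.logTheta {W : ℝ → ℂ} (hW : HasCompactSupport W) :
    HasCompactSupport (logTheta W) := hW.deriv.deriv.mul_left

lemma HasCompactSupport.logTheta_iterate {W : ℝ → ℂ} (hW : HasCompactSupport W) (m : ℕ) :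
    HasCompactSupport (_root_.logTheta^[m] W) := by
  induction m with
  | zero => exact hW
  | succ m ih =>
    rw [Function.iterate_succ_apply']
    exact ih.logTheta

lemma exists_hasDerivAt_contDiff {n : ℕ} {h : ℝ → ℂ} (hh : ContDiff ℝ n h) :
    ∃ H : ℝ → ℂ, ContDiff ℝ ((n + 1 : ℕ) : WithTop ℕ∞) H ∧ deriv H = h := by
  have hd : ∀ t, HasDerivAt (fun t => ∫ s in (0 : ℝ)..t, h s) (h t) t := fun t =>
    (hh.continuous.integral_hasStrictDerivAt 0 t).hasDerivAt
  have e : deriv (fun t => ∫ s in (0 : ℝ)..t, h s) = h := funext fun t => (hd t).deriv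
  refine ⟨fun t => ∫ s in (0 : ℝ)..t, h s, ?_, e⟩
  rw [show ((n + 1 : ℕ) : WithTop ℕ∞) = (n : WithTop ℕ∞) + 1 by push_cast; rfl,
    contDiff_succ_iff_deriv, e]
  exact ⟨fun t => (hd t).differentiableAt, by simp, hh⟩

/-- Solving `W'' = e^t h` takes two antiderivatives, hence the gain of two orders of smoothness. -/
lemma exists_logTheta_eq {n : ℕ} {h : ℝ → ℂ} (hh : ContDiff ℝ n h) :
    ∃ W : ℝ → ℂ, ContDiff ℝ ((n + 2 : ℕ) : WithTop ℕ∞) W ∧ logTheta W = h := by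
  obtain ⟨H, hH, hH'⟩ := exists_hasDerivAt_contDiff
    ((ofRealCLM.contDiff (n := n)).cexp.mul hh)
  obtain ⟨W, hW, hW'⟩ := exists_hasDerivAt_contDiff hH
  refine ⟨W, hW, ?_⟩
  funext t
  rw [logTheta, hW', hH']
  simp only [ofRealCLM_apply]
  rw [← mul_assoc, ← Complex.exp_add]
  simp

lemma exists_logTheta_iterate_eq (m : ℕ) {n : ℕ} {h : ℝ → ℂ} (hh : ContDiff ℝ n h) :
    ∃ W : ℝ → ℂ, ContDiff ℝ ((n + 2 * m : ℕ) : WithTop ℕ∞) W ∧ logTheta^[m] W = h := by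
  induction m with
  | zero => exact ⟨h, by simpa using hh, rfl⟩
  | succ m ih =>
    obtain ⟨V, hV, hV'⟩ := ih
    obtain ⟨W, hW, hW'⟩ := exists_logTheta_eq hV
    refine ⟨W, hW, ?_⟩
    rw [Function.iterate_succ_apply, hW', hV']

/-- `θ` is formally self-adjoint. -/
lemma integral_mul_logTheta {W ψ : ℝ → ℂ} (hW : ContDiff ℝ 2 W) (hψ : ContDiff ℝ 2 ψ)
    (hs : HasCompactSupport ψ) :
    ∫ t : ℝ, cexp t * W t * logTheta ψ t = ∫ t : ℝ, cexp t * logTheta W t * ψ t := by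
  have hW1 : ContDiff ℝ 1 (deriv W) := ContDiff.deriv' (by rwa [one_add_one_eq_two])
  have hψ1 : ContDiff ℝ 1 (deriv ψ) := ContDiff.deriv' (by rwa [one_add_one_eq_two])
  have hW2 : Continuous (deriv (deriv W)) := hW1.continuous_deriv le_rfl
  have hψ2 : Continuous (deriv (deriv ψ)) := hψ1.continuous_deriv le_rfl
  have hi : ∀ f g : ℝ → ℂ, Continuous f → Continuous g → HasCompactSupport g →
      Integrable (f * g) := fun f g hf hg hgs =>
    Continuous.integrable_of_hasCompactSupport (hf.mul hg) hgs.mul_left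
  have d : ∀ f : ℝ → ℂ, ContDiff ℝ 1 f → ∀ t, HasDerivAt f (deriv f t) t := fun f hf t =>
    (hf.differentiable one_ne_zero t).hasDerivAt
  have hWc := hW.continuous
  have hψc := hψ.continuous
  have h1 := integral_mul_deriv_eq_deriv_mul_of_integrable (fun t _ => d W (hW.of_le one_le_two) t)
    (fun t _ => d _ hψ1 t) (hi _ _ hWc hψ2 hs.deriv.deriv) (hi _ _ hW1.continuous hψ1.continuous
      hs.deriv) (hi _ _ hWc hψ1.continuous hs.deriv)
  have h2 := integral_mul_deriv_eq_deriv_mul_of_integrable (fun t _ => d _ hW1 t)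
    (fun t _ => d ψ (hψ.of_le one_le_two) t) (hi _ _ hW1.continuous hψ1.continuous hs.deriv)
    (hi _ _ hW2 hψc hs) (hi _ _ hW1.continuous hψc hs)
  have e1 : ∀ t : ℝ, cexp t * W t * logTheta ψ t = W t * deriv (deriv ψ) t := by
    intro t
    have : cexp t * cexp (-t) = 1 := by rw [← Complex.exp_add]; simp
    rw [logTheta]
    linear_combination (W t * deriv (deriv ψ) t) * this
  have e2 : ∀ t : ℝ, cexp t * logTheta W t * ψ t = deriv (deriv W) t * ψ t := by
    intro t
    have : cexp t * cexp (-t) = 1 := by rw [← Complex.exp_add]; simp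
    rw [logTheta]
    linear_combination (deriv (deriv W) t * ψ t) * this
  simp only [e1, e2]
  rw [h1, h2, neg_neg]

lemma integral_mul_logTheta_iterate {m : ℕ} {W ψ : ℝ → ℂ}
    (hW : ContDiff ℝ ((2 * m : ℕ) : WithTop ℕ∞) W) (hψ : ContDiff ℝ ∞ ψ)
    (hs : HasCompactSupport ψ) :
    ∫ t : ℝ, cexp t * W t * logTheta^[m] ψ t = ∫ t : ℝ, cexp t * logTheta^[m] W t * ψ t := by
  induction m generalizing ψ with
  | zero => rfl
  | succ m ih =>
    rw [Function.iterate_succ_apply, ih (hW.of_le (by norm_cast; lia))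
      (contDiff_infty_logTheta hψ) hs.logTheta, Function.iterate_succ_apply']
    refine integral_mul_logTheta ?_ (by exact_mod_cast contDiff_infty.1 hψ 2) hs
    exact contDiff_logTheta_iterate (n := 2) (hW.of_le (by norm_cast; lia))

lemma eq_of_forall_integral_test_eq {A B : ℝ → ℂ} (hA : Continuous A) (hB : Continuous B)
    (h : ∀ ψ : ℝ → ℂ, ContDiff ℝ ∞ ψ → HasCompactSupport ψ →
      ∫ t : ℝ, cexp t * A t * ψ t = ∫ t : ℝ, cexp t * B t * ψ t) : A = B := by
  refine (hA.ae_eq_iff_eq volume hB).1 ?_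
  refine ae_eq_of_integral_contDiff_smul_eq hA.locallyIntegrable hB.locallyIntegrable
    fun g hg hgs => ?_
  have hgs' : HasCompactSupport fun t => (g t : ℂ) := hgs.comp_left (g := ofReal) ofReal_zero
  have := h (fun t => cexp (-t) * (g t : ℂ))
    (contDiff_cexp_neg_ofReal.mul (ofRealCLM.contDiff.comp hg)) hgs'.mul_left
  have e : ∀ (C : ℝ → ℂ) (t : ℝ), g t • C t = cexp t * C t * (cexp (-t) * (g t : ℂ)) := by
    intro C t
    have h1 : cexp t * cexp (-t) = 1 := by rw [← Complex.exp_add]; simp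
    rw [real_smul]
    linear_combination (-(g t * C t)) * h1
  simpa only [e] using this

/-- The homogeneity of `θ` under dilations of `x`. It is what lets weak solutions of `θ^m v = 0` be
translated, and so mollified. -/
lemma logTheta_iterate_comp_add (m : ℕ) (W : ℝ → ℂ) (h : ℝ) :
    logTheta^[m] (fun t => W (t + h)) = fun t => cexp (m * h) * logTheta^[m] W (t + h) := by
  induction m with
  | zero => simp
  | succ m ih =>
    rw [Function.iterate_succ_apply', ih, Function.iterate_succ_apply']
    funext t
    have e1 : deriv (fun t => cexp (m * h) * logTheta^[m] W (t + h))
        = fun t => cexp (m * h) * deriv (logTheta^[m] W) (t + h) := by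
      funext t
      rw [deriv_const_mul_field, deriv_comp_add_const]
    rw [logTheta, e1, deriv_const_mul_field, deriv_comp_add_const, logTheta]
    push_cast
    have e2 : cexp (-t) = cexp h * cexp (-(t + h)) := by rw [← Complex.exp_add]; ring_nf
    have e3 : cexp ((m + 1) * h) = cexp (m * h) * cexp h := by rw [← Complex.exp_add]; ring_nf
    rw [e2, e3]
    ring

/-! ### Regularity of weak solutions of `θ^m w = h` -/

/-- Smooth functions on the line. -/
def smoothFunctions : Submodule ℂ (ℝ → ℂ) where
  carrier := {W | ContDiff ℝ ∞ W}
  add_mem' ha hb := by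
    rw [mem_ofPred_eq] at *
    exact ha.add hb
  zero_mem' := by
    rw [mem_ofPred_eq]
    exact contDiff_const
  smul_mem' c _ h := by
    rw [mem_ofPred_eq] at *
    exact contDiff_const.smul h

/-- The Laguerre derivative in the coordinate `log x` as a linear map. -/
noncomputable def logThetaLinear : smoothFunctions →ₗ[ℂ] smoothFunctions where
  toFun W := ⟨logTheta W, contDiff_infty_logTheta W.2⟩
  map_add' := by
    rintro ⟨V, hV⟩ ⟨W, hW⟩
    ext t
    have hV : ContDiff ℝ ∞ V := hV
    have hW : ContDiff ℝ ∞ W := hW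
    have hV1 := (contDiff_infty_iff_deriv.1 hV).2
    have hW1 := (contDiff_infty_iff_deriv.1 hW).2
    have e : deriv (V + W) = deriv V + deriv W := funext fun s =>
      deriv_add (hV.differentiable (by simp) s) (hW.differentiable (by simp) s)
    change logTheta (V + W) t = logTheta V t + logTheta W t
    simp only [logTheta]
    rw [e, deriv_add (hV1.differentiable (by simp) t) (hW1.differentiable (by simp) t), mul_add]
  map_smul' := by
    rintro c ⟨W, hW⟩
    ext t
    have e : deriv (c • W) = c • deriv W := funext fun s => deriv_const_smul_field c W
    change logTheta (c • W) t = c * logTheta W t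
    simp only [logTheta]
    rw [e, deriv_const_smul_field, smul_eq_mul]
    ring

lemma logThetaLinear_pow_apply (m : ℕ) (W : smoothFunctions) :
    (((logThetaLinear ^ m) W : smoothFunctions) : ℝ → ℂ) = logTheta^[m] W := by
  induction m with
  | zero => rfl
  | succ m ih =>
    rw [pow_succ', Module.End.mul_apply, Function.iterate_succ_apply', ← ih]
    rfl

/-- The equation is `W'' = 0`, so its solutions are spanned by `1` and `t`. -/
lemma fg_ker_logThetaLinear : (LinearMap.ker logThetaLinear).FG := by
  have h1 : ContDiff ℝ ∞ fun _ : ℝ => (1 : ℂ) := contDiff_const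
  have h2 : ContDiff ℝ ∞ fun t : ℝ => (t : ℂ) := ofRealCLM.contDiff
  set e₁ : smoothFunctions := ⟨_, h1⟩
  set e₂ : smoothFunctions := ⟨_, h2⟩
  have hle : LinearMap.ker logThetaLinear ≤ Submodule.span ℂ {e₁, e₂} := by
    rintro ⟨W, hW⟩ hker
    have hW : ContDiff ℝ ∞ W := hW
    have hW1 := (contDiff_infty_iff_deriv.1 hW).2
    have hz : ∀ t, deriv (deriv W) t = 0 := by
      intro t
      have h3 : logTheta W t = 0 := congrFun (congrArg Subtype.val (LinearMap.mem_ker.1 hker)) t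
      rw [logTheta] at h3
      exact (mul_eq_zero.1 h3).resolve_left (Complex.exp_ne_zero _)
    have hc : ∀ t, deriv W t = deriv W 0 := fun t =>
      is_const_of_deriv_eq_zero (hW1.differentiable (by simp)) hz t 0
    have hlin : ∀ t : ℝ, W t = W 0 + deriv W 0 * t := by
      have hd : Differentiable ℝ fun t : ℝ => W t - deriv W 0 * t :=
        (hW.differentiable (by simp)).sub ((h2.differentiable (by simp)).const_mul _)
      have hz2 : ∀ t, deriv (fun t : ℝ => W t - deriv W 0 * t) t = 0 := by
        intro t
        have h4 : HasDerivAt (fun t : ℝ => (t : ℂ)) 1 t := by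
          simpa using (hasDerivAt_id t).ofReal_comp
        have h5 := ((hW.differentiable (by simp) t).hasDerivAt).sub (h4.const_mul (deriv W 0))
        refine h5.deriv.trans ?_
        rw [hc t]
        simp
      intro t
      have := is_const_of_deriv_eq_zero hd hz2 t 0
      simp only [ofReal_zero, mul_zero, sub_zero] at this
      rw [← this]
      ring
    rw [Submodule.mem_span_pair]
    refine ⟨W 0, deriv W 0, ?_⟩
    ext t
    simp [e₁, e₂, hlin t]
  have : FiniteDimensional ℂ (Submodule.span ℂ {e₁, e₂}) :=
    FiniteDimensional.span_of_finite ℂ (by simp)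
  have := Submodule.finiteDimensional_of_le hle
  exact Submodule.fg_iff_finiteDimensional _ |>.2 this

/-- Induction: `θ` maps the kernel of `θ^{m+1}` into that of `θ^m`, with finite-dimensional kernel.
-/
lemma fg_ker_logThetaLinear_pow (m : ℕ) : (LinearMap.ker (logThetaLinear ^ m)).FG := by
  induction m with
  | zero =>
    rw [pow_zero, Module.End.one_eq_id, LinearMap.ker_id]
    exact Submodule.fg_bot
  | succ m ih =>
    have hle {s t : Submodule ℂ smoothFunctions} (ht : t.FG) (hst : s ≤ t) : s.FG := by
      have := (Submodule.fg_iff_finiteDimensional _).1 ht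
      exact (Submodule.fg_iff_finiteDimensional _).2 (Submodule.finiteDimensional_of_le hst)
    refine Submodule.fg_of_fg_map_of_fg_inf_ker logThetaLinear (hle ih ?_)
      (hle fg_ker_logThetaLinear inf_le_right)
    rintro _ ⟨W, hW, rfl⟩
    rw [SetLike.mem_coe, LinearMap.mem_ker, pow_succ, Module.End.mul_apply] at hW
    exact hW

/-- The smooth solutions of `θ^m W = 0` are closed under pointwise limits. -/
lemma isClosed_setOf_logTheta_iterate_eq_zero (m : ℕ) :
    IsClosed {W : ℝ → ℂ | ContDiff ℝ ∞ W ∧ logTheta^[m] W = 0} := by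
  set V := (LinearMap.ker (logThetaLinear ^ m)).map smoothFunctions.subtype
  have hV : FiniteDimensional ℂ V :=
    (Submodule.fg_iff_finiteDimensional _).1 ((fg_ker_logThetaLinear_pow m).map _)
  -- A finite-dimensional subspace is closed in the topology of pointwise convergence on `ℝ → ℂ`.
  convert V.closed_of_finiteDimensional using 1
  ext W
  constructor
  · rintro ⟨hW, h0⟩
    refine ⟨⟨W, hW⟩, ?_, rfl⟩
    rw [SetLike.mem_coe, LinearMap.mem_ker]
    ext1
    rw [logThetaLinear_pow_apply]
    exact h0
  · rintro ⟨⟨W, hW⟩, h0, rfl⟩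
    refine ⟨hW, ?_⟩
    rw [SetLike.mem_coe, LinearMap.mem_ker] at h0
    have := logThetaLinear_pow_apply m ⟨W, hW⟩
    rw [h0] at this
    exact this.symm

/-- Mollifications of a weak solution of `θ^m v = 0` are solutions. -/
lemma logTheta_iterate_convolution_eq_zero {m : ℕ} {v : ℝ → ℂ} (hv : Continuous v)
    (h : ∀ ψ : ℝ → ℂ, ContDiff ℝ ∞ ψ → HasCompactSupport ψ →
      ∫ t : ℝ, cexp t * v t * logTheta^[m] ψ t = 0) {ρ : ℝ → ℝ} (hρ : ContDiff ℝ ∞ ρ)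
    (hρs : HasCompactSupport ρ) :
    ContDiff ℝ ∞ (convolution ρ v (ContinuousLinearMap.lsmul ℝ ℝ) volume) ∧
      logTheta^[m] (convolution ρ v (ContinuousLinearMap.lsmul ℝ ℝ) volume) = 0 := by
  have hsm : ContDiff ℝ ∞ (convolution ρ v (ContinuousLinearMap.lsmul ℝ ℝ) volume) :=
    hρs.contDiff_convolution_left _ hρ hv.locallyIntegrable
  refine ⟨hsm, ?_⟩
  refine eq_of_forall_integral_test_eq (contDiff_infty_logTheta_iterate hsm m).continuous
    continuous_zero fun ψ hψ hψs => ?_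
  rw [← integral_mul_logTheta_iterate (contDiff_infty.1 hsm (2 * m)) hψ hψs]
  simp only [Pi.zero_apply, mul_zero, zero_mul, integral_zero]
  set N := logTheta^[m] ψ with hN
  have hNc : Continuous N := (contDiff_infty_logTheta_iterate hψ m).continuous
  have hNs : HasCompactSupport N := hψs.logTheta_iterate m
  have hρc := hρ.continuous
  have hsw := integral_integral_swap_of_hasCompactSupport (μ := (volume : Measure ℝ))
    (ν := (volume : Measure ℝ))
    (f := fun t y : ℝ => (ρ y : ℂ) * (cexp t * v (t - y) * N t)) (by
      simp only [Function.uncurry_def]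
      fun_prop) (by
      refine HasCompactSupport.intro (hNs.isCompact.prod hρs.isCompact) fun p hp => ?_
      simp only [Function.uncurry_def]
      by_cases h1 : p.1 ∈ tsupport N
      · have h2 : p.2 ∉ tsupport ρ := fun h2 => hp ⟨h1, h2⟩
        rw [image_eq_zero_of_notMem_tsupport h2]
        simp
      · rw [image_eq_zero_of_notMem_tsupport h1]
        simp)
  calc ∫ t : ℝ, cexp t * convolution ρ v (ContinuousLinearMap.lsmul ℝ ℝ) volume t * N t
      = ∫ t : ℝ, ∫ y : ℝ, (ρ y : ℂ) * (cexp t * v (t - y) * N t) := by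
        congr 1
        funext t
        rw [convolution_def, ← integral_const_mul, ← integral_mul_const]
        congr 1
        funext y
        simp only [ContinuousLinearMap.lsmul_apply, real_smul]
        ring
    _ = ∫ y : ℝ, ∫ t : ℝ, (ρ y : ℂ) * (cexp t * v (t - y) * N t) := hsw
    _ = ∫ y : ℝ, (0 : ℂ) := by
        congr 1
        funext y
        rw [integral_const_mul]
        -- Translating `v` amounts to translating the test function the other way, so each inner
        -- integral is a multiple of one that vanishes by hypothesis.
        have h3 := h (fun t => ψ (t + y)) (hψ.comp (contDiff_id.add contDiff_const))
          (hψs.comp_homeomorph (Homeomorph.addRight y))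
        rw [logTheta_iterate_comp_add] at h3
        have h4 : ∫ t : ℝ, cexp t * v (t - y) * N t
            = cexp y * cexp (-(m * y)) *
              ∫ t : ℝ, cexp t * v t * (cexp (m * y) * N (t + y)) := by
          rw [← integral_add_right_eq_self _ y, ← integral_const_mul]
          congr 1
          funext t
          have e1 : cexp (-(m * y)) * cexp (m * y) = 1 := by rw [← Complex.exp_add]; simp
          rw [add_sub_cancel_right]
          push_cast
          rw [Complex.exp_add]
          linear_combination (-(cexp t * cexp y * v t * N (t + y))) * e1
        rw [h4, h3, mul_zero, mul_zero]
    _ = 0 := integral_zero _ _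

/-- A continuous weak solution of `θ^m v = 0` is a smooth solution. -/
lemma contDiff_of_weak_logTheta_eq_zero {m : ℕ} {v : ℝ → ℂ} (hv : Continuous v)
    (h : ∀ ψ : ℝ → ℂ, ContDiff ℝ ∞ ψ → HasCompactSupport ψ →
      ∫ t : ℝ, cexp t * v t * logTheta^[m] ψ t = 0) : ContDiff ℝ ∞ v := by
  let φ : ℕ → ContDiffBump (0 : ℝ) := fun n =>
    ⟨1 / (n + 1) / 2, 1 / (n + 1), by positivity, half_lt_self (by positivity)⟩
  have hφ : Filter.Tendsto (fun n => (φ n).rOut) Filter.atTop (nhds 0) :=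
    tendsto_one_div_add_atTop_nhds_zero_nat
  have hlim : Filter.Tendsto (fun n => convolution ((φ n).normed volume) v
      (ContinuousLinearMap.lsmul ℝ ℝ) volume) Filter.atTop (nhds v) :=
    tendsto_pi_nhds.2 fun t => ContDiffBump.convolution_tendsto_right_of_continuous hφ hv t
  -- The mollifications are smooth solutions and converge pointwise to `v`; closedness of the
  -- solution space passes smoothness to the limit.
  exact ((isClosed_setOf_logTheta_iterate_eq_zero m).mem_of_tendsto hlim
    (Filter.Eventually.of_forall fun n => logTheta_iterate_convolution_eq_zero hv h
      (φ n).contDiff_normed (φ n).hasCompactSupport_normed)).1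

/-- A continuous weak solution of `θ^m w = h` with continuous `h` is a classical solution. -/
lemma contDiff_of_weak_logTheta {m : ℕ} {w h : ℝ → ℂ} (hw : Continuous w) (hh : Continuous h)
    (hwh : ∀ ψ : ℝ → ℂ, ContDiff ℝ ∞ ψ → HasCompactSupport ψ →
      ∫ t : ℝ, cexp t * w t * logTheta^[m] ψ t = ∫ t : ℝ, cexp t * h t * ψ t) :
    ContDiff ℝ ((2 * m : ℕ) : WithTop ℕ∞) w ∧ logTheta^[m] w = h := by
  -- Subtracting a classical solution `W` reduces to the homogeneous equation, so `w` inherits the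
  -- regularity of `W`.
  obtain ⟨W, hW, hWh⟩ := exists_logTheta_iterate_eq m (n := 0) (contDiff_zero.2 hh)
  rw [zero_add] at hW
  have hv : ContDiff ℝ ∞ (w - W) := by
    refine contDiff_of_weak_logTheta_eq_zero (m := m) (hw.sub hW.continuous) fun ψ hψ hψs => ?_
    have hN : Continuous (logTheta^[m] ψ) := (contDiff_infty_logTheta_iterate hψ m).continuous
    have hNs := hψs.logTheta_iterate m
    have hi : ∀ f : ℝ → ℂ, Continuous f → Integrable fun t : ℝ => cexp t * f t * logTheta^[m] ψ t :=
      fun f hf => Continuous.integrable_of_hasCompactSupport (by fun_prop) hNs.mul_left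
    simp only [Pi.sub_apply, mul_sub, sub_mul]
    rw [integral_sub (hi w hw) (hi W hW.continuous), hwh ψ hψ hψs,
      integral_mul_logTheta_iterate hW hψ hψs, hWh, sub_self]
  have hwC : ContDiff ℝ ((2 * m : ℕ) : WithTop ℕ∞) w := by
    have := (contDiff_infty.1 hv (2 * m)).add hW
    simpa using this
  refine ⟨hwC, ?_⟩
  refine eq_of_forall_integral_test_eq ?_ hh fun ψ hψ hψs => ?_
  · exact (contDiff_logTheta_iterate (n := 0) (by simpa using hwC)).continuous
  · rw [← integral_mul_logTheta_iterate hwC hψ hψs, hwh ψ hψ hψs]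

/-! ### The right-sided integral -/

/-- Proved by duality, since only pointwise convergence of the right-sided integral is available and
`c'` may lie outside the strip of its kernel. The multiplier is evaluated on the left-hand line `c <
1`, where it exists, at `-τ`. -/
lemma logRight_spec {β : ℝ} (hβ : 0 < β) (hβ1 : β ≤ 1) {m : ℕ} (hm : β ≤ m) {c c' : ℝ}
    (hc : c < 1) (hcc : c + c' = 1 + β - m) {F : ℝ → ℂ} (hFc : Continuous F)
    (hF : ExpIntegrable c' F) (hFw : WeightedIntegrable (2 * (m - β)) (lineTransform c' F))
    (hi : ∀ t : ℝ, Integrable fun s : ℝ =>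
      (logKernel β (s - t) : ℂ) * (cexp ((β + 1) * s) * F s)) :
    ContDiff ℝ ((2 * m : ℕ) : WithTop ℕ∞) (logRight β F) ∧
      logTheta^[m] (logRight β F) = lineInverse (c' - β + m)
        fun τ => laguerreMultiplier β m c (-τ) * lineTransform c' F τ := by
  have hFM := hFw.integrable_laguerreMultiplier_neg_mul hβ hβ1 hc
  have hw : Continuous (logRight β F) := by
    unfold logRight
    exact Continuous.mul (by fun_prop)
      (continuous_integral_logKernel_sub hβ hβ1 (by fun_prop) hi)
  refine contDiff_of_weak_logTheta hw (continuous_lineInverse _ hFM) fun ψ hψ hψs => ?_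
  have hψM := (hψs.weightedIntegrable_lineTransform hψ
    (2 * (m - β)) c).integrable_laguerreMultiplier_mul hβ hβ1 hc
  rw [integral_logRight_mul hβ hβ1 hFc hi (contDiff_infty_logTheta_iterate hψ m).continuous
    (hψs.logTheta_iterate m), logLeft_logTheta_iterate hβ hβ1 hc hm hψs hψ,
    integral_laguerreMultiplier_adjoint hcc hF (hψs.expIntegrable hψ.continuous c) hFM hψM]
  congr 1
  funext t
  ring

/-- The inverse transform is `O(e^{-cs})`, so the kernel is integrated against `e^{(β+1-c)s}`; this
converges when `β + 1 - c < 1`, that is, when `c > β`. -/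
lemma integrable_logKernel_right {β : ℝ} (hβ : 0 < β) (hβ1 : β ≤ 1) {c : ℝ} (hc : β < c)
    {φ : ℝ → ℂ} (hφ : Integrable φ) (t : ℝ) : Integrable fun s : ℝ =>
      (logKernel β (s - t) : ℂ) * (cexp ((β + 1) * s) * lineInverse c φ s) := by
  have h := ((integrable_logKernel_mul_exp hβ hβ1
    (c := β + 1 - c) (by linarith)).comp_sub_right t).ofReal (𝕜 := ℂ)
  have hcont : Continuous fun s : ℝ =>
      cexp ((β + 1) * s) * lineInverse c φ s * cexp (-((β + 1 - c) * (s - t))) :=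
    (Continuous.mul (by fun_prop) (continuous_lineInverse c hφ)).mul (by fun_prop)
  have h2 := h.mul_bdd (c := Real.exp ((β + 1 - c) * t) * ((2 * Real.pi)⁻¹ * ∫ τ, ‖φ τ‖))
    hcont.aestronglyMeasurable (Filter.Eventually.of_forall fun s => ?_)
  · refine h2.congr (Filter.Eventually.of_forall fun s => ?_)
    simp only [coe_algebraMap]
    have e : cexp ((β + 1 - c) * (s - t)) * cexp (-((β + 1 - c) * (s - t))) = 1 := by
      rw [← Complex.exp_add, add_neg_cancel, Complex.exp_zero]
    push_cast
    linear_combination ((logKernel β (s - t) : ℂ) * cexp ((β + 1) * s) * lineInverse c φ s) * e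
  · rw [norm_mul, norm_mul, Complex.norm_exp, Complex.norm_exp]
    have e1 : (((β : ℂ) + 1) * s).re = (β + 1) * s := by
      rw [← ofReal_one, ← ofReal_add, ← ofReal_mul, ofReal_re]
    have e2 : (-(((β : ℂ) + 1 - c) * (s - t))).re = -((β + 1 - c) * (s - t)) := by
      rw [← ofReal_one, ← ofReal_add, ← ofReal_sub, ← ofReal_sub, ← ofReal_mul, ← ofReal_neg,
        ofReal_re]
    rw [e1, e2]
    calc _ ≤ Real.exp ((β + 1) * s) * (Real.exp (-(c * s)) * ((2 * Real.pi)⁻¹ * ∫ τ, ‖φ τ‖)) *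
          Real.exp (-((β + 1 - c) * (s - t))) := by
          gcongr
          exact norm_lineInverse_le _ _ _
      _ = (Real.exp ((β + 1) * s) * Real.exp (-(c * s)) * Real.exp (-((β + 1 - c) * (s - t)))) *
          ((2 * Real.pi)⁻¹ * ∫ τ, ‖φ τ‖) := by ring
      _ ≤ _ := by
          rw [← Real.exp_add, ← Real.exp_add]
          apply le_of_eq
          ring_nf

/-! ### Transfer between the half-axis and the coordinate `log x` -/

lemma integrableOn_exp_image_iff {S : Set ℝ} (hS : MeasurableSet S) (h : ℝ → ℂ) :
    IntegrableOn h (Real.exp '' S) ↔ IntegrableOn (fun t : ℝ => cexp t * h (Real.exp t)) S := by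
  rw [integrableOn_image_iff_integrableOn_abs_deriv_smul hS
    (fun t _ => (Real.hasDerivAt_exp t).hasDerivWithinAt) Real.exp_injective.injOn]
  simp only [Real.abs_exp, real_smul, ofReal_exp]

lemma setIntegral_exp_image {S : Set ℝ} (hS : MeasurableSet S) (h : ℝ → ℂ) :
    ∫ x in Real.exp '' S, h x = ∫ t in S, cexp t * h (Real.exp t) := by
  rw [integral_image_eq_integral_abs_deriv_smul hS
    (fun t _ => (Real.hasDerivAt_exp t).hasDerivWithinAt) Real.exp_injective.injOn]
  simp only [Real.abs_exp, real_smul, ofReal_exp]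

lemma exp_image_univ : Real.exp '' univ = Ioi 0 := by rw [image_univ, Real.range_exp]

lemma exp_image_Iio (t : ℝ) : Real.exp '' Iio t = Ioo 0 (Real.exp t) := by
  ext x
  constructor
  · rintro ⟨s, hs, rfl⟩
    exact ⟨Real.exp_pos s, Real.exp_lt_exp.2 hs⟩
  · intro hx
    exact ⟨Real.log x, (Real.log_lt_iff_lt_exp hx.1).2 hx.2, Real.exp_log hx.1⟩

lemma exp_image_Ioi (t : ℝ) : Real.exp '' Ioi t = Ioi (Real.exp t) := by
  ext x
  constructor
  · rintro ⟨s, hs, rfl⟩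
    exact Real.exp_lt_exp.2 hs
  · intro hx
    have h0 : 0 < x := (Real.exp_pos t).trans hx
    exact ⟨Real.log x, (Real.lt_log_iff_exp_lt h0).2 hx, Real.exp_log h0⟩

lemma integrableOn_Ioi_zero_iff (h : ℝ → ℂ) :
    IntegrableOn h (Ioi 0) ↔ Integrable fun t : ℝ => cexp t * h (Real.exp t) := by
  rw [← exp_image_univ, integrableOn_exp_image_iff MeasurableSet.univ, integrableOn_univ]

lemma setIntegral_Ioi_zero (h : ℝ → ℂ) :
    ∫ x in Ioi 0, h x = ∫ t : ℝ, cexp t * h (Real.exp t) := by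
  rw [← exp_image_univ, setIntegral_exp_image MeasurableSet.univ, setIntegral_univ]

lemma memWeightedL1_iff (c : ℝ) (f : ℝ → ℂ) :
    MemWeightedL1 c f ↔ ExpIntegrable c fun t => f (Real.exp t) := by
  rw [MemWeightedL1, integrableOn_Ioi_zero_iff, ExpIntegrable]
  refine integrable_congr (Filter.Eventually.of_forall fun t => ?_)
  simp only
  rw [← Real.exp_mul, ofReal_exp, ← mul_assoc, ← Complex.exp_add, mul_comm]
  push_cast
  ring_nf

lemma lineTransform_comp_exp (c : ℝ) (f : ℝ → ℂ) (τ : ℝ) :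
    lineTransform c (fun t => f (Real.exp t)) τ = mellin f (c + τ * I) := by
  rw [mellin, setIntegral_Ioi_zero, lineTransform]
  congr 1
  funext t
  have e : ((Real.exp t : ℝ) : ℂ) ^ ((c : ℂ) + τ * I - 1) = cexp (t * (c + τ * I - 1)) := by
    rw [cpow_def_of_ne_zero (ofReal_ne_zero.2 (Real.exp_pos t).ne'),
      ← ofReal_log (Real.exp_pos t).le, Real.log_exp]
  rw [smul_eq_mul, e, ← mul_assoc, ← Complex.exp_add, mul_comm]
  ring_nf

lemma cexp_mul_laguerreLeftIntegrand {β : ℝ} (hβ : 0 < β) (g : ℝ → ℂ) {s t : ℝ} (hst : s < t) :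
    cexp s * laguerreLeftIntegrand β g (Real.exp t) (Real.exp s)
      = Real.Gamma (2 * β) * cexp (β * t) * ((logKernel β (t - s) : ℂ) * g (Real.exp s)) := by
  have hG2 := (Real.Gamma_pos_of_pos (show 0 < 2 * β by positivity)).ne'
  have h := laguerreKernel_exp hβ hst
  rw [one_div, mul_assoc, inv_mul_eq_iff_eq_mul₀ hG2] at h
  have h' := congrArg (fun x : ℝ => (x : ℂ)) h
  simp only [ofReal_mul, ofReal_exp] at h'
  rw [laguerreLeftIntegrand]
  simp only [ofReal_mul]
  linear_combination (g (Real.exp s)) * h'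

lemma cexp_mul_laguerreRightIntegrand {β : ℝ} (hβ : 0 < β) (f : ℝ → ℂ) {s t : ℝ} (hst : t < s) :
    cexp s * laguerreRightIntegrand β f (Real.exp t) (Real.exp s)
      = Real.Gamma (2 * β) * cexp ((β - 1) * t) *
        ((logKernel β (s - t) : ℂ) * (cexp ((β + 1) * s) * f (Real.exp s))) := by
  have hG2 := (Real.Gamma_pos_of_pos (show 0 < 2 * β by positivity)).ne'
  have h := laguerreKernel_exp hβ hst
  rw [one_div, mul_assoc, inv_mul_eq_iff_eq_mul₀ hG2, ← Real.exp_mul] at h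
  have h' := congrArg (fun x : ℝ => (x : ℂ)) h
  simp only [ofReal_mul, ofReal_exp, ofReal_neg] at h'
  rw [laguerreRightIntegrand]
  simp only [ofReal_mul]
  have e1 : cexp ((β - 1) * t) * cexp (t * -β) * cexp t = 1 := by
    rw [← Complex.exp_add, ← Complex.exp_add,
      show ((β : ℂ) - 1) * t + t * -β + t = 0 by ring, Complex.exp_zero]
  have e2 : cexp ((β + 1) * s) = cexp s * cexp (β * s) := by
    rw [← Complex.exp_add]; ring_nf
  rw [e2]
  linear_combination (cexp ((β - 1) * t) * cexp s * f (Real.exp s)) * h' -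
    (cexp s * f (Real.exp s) * (((Real.exp s - Real.exp t) ^ (2 * β - 1) : ℝ) : ℂ) *
      (gaussHypergeometric β β (2 * β) (1 - Real.exp s / Real.exp t) : ℂ)) * e1

lemma laguerreLeft_integrableOn_iff {β : ℝ} (hβ : 0 < β) (g : ℝ → ℂ) (t : ℝ) :
    IntegrableOn (laguerreLeftIntegrand β g (Real.exp t)) (Ioo 0 (Real.exp t)) ↔
      Integrable fun s : ℝ => (logKernel β (t - s) : ℂ) * g (Real.exp s) := by
  have hG2 := (Real.Gamma_pos_of_pos (show 0 < 2 * β by positivity)).ne'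
  have he : EqOn (fun s : ℝ => cexp s * laguerreLeftIntegrand β g (Real.exp t) (Real.exp s))
      (fun s : ℝ => Real.Gamma (2 * β) * cexp (β * t) *
        ((logKernel β (t - s) : ℂ) * g (Real.exp s))) (Iio t) :=
    fun s hs => cexp_mul_laguerreLeftIntegrand hβ g hs
  rw [← exp_image_Iio, integrableOn_exp_image_iff measurableSet_Iio,
    integrableOn_congr_fun he measurableSet_Iio,
    IntegrableOn, integrable_const_mul_iff, ← IntegrableOn,
    integrableOn_iff_integrable_of_support_subset]
  · intro s hs
    by_contra h
    refine hs ?_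
    simp [logKernel_of_nonpos β (sub_nonpos.2 (not_lt.1 h))]
  · exact isUnit_iff_ne_zero.2 (mul_ne_zero (ofReal_ne_zero.2 hG2) (Complex.exp_ne_zero _))

lemma laguerreRight_integrableOn_iff {β : ℝ} (hβ : 0 < β) (f : ℝ → ℂ) (t : ℝ) :
    IntegrableOn (laguerreRightIntegrand β f (Real.exp t)) (Ioi (Real.exp t)) ↔
      Integrable fun s : ℝ =>
        (logKernel β (s - t) : ℂ) * (cexp ((β + 1) * s) * f (Real.exp s)) := by
  have hG2 := (Real.Gamma_pos_of_pos (show 0 < 2 * β by positivity)).ne'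
  have he : EqOn (fun s : ℝ => cexp s * laguerreRightIntegrand β f (Real.exp t) (Real.exp s))
      (fun s : ℝ => Real.Gamma (2 * β) * cexp ((β - 1) * t) *
        ((logKernel β (s - t) : ℂ) * (cexp ((β + 1) * s) * f (Real.exp s)))) (Ioi t) :=
    fun s hs => cexp_mul_laguerreRightIntegrand hβ f hs
  rw [← exp_image_Ioi, integrableOn_exp_image_iff measurableSet_Ioi,
    integrableOn_congr_fun he measurableSet_Ioi,
    IntegrableOn, integrable_const_mul_iff, ← IntegrableOn,
    integrableOn_iff_integrable_of_support_subset]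
  · intro s hs
    by_contra h
    refine hs ?_
    simp [logKernel_of_nonpos β (sub_nonpos.2 (not_lt.1 h))]
  · exact isUnit_iff_ne_zero.2 (mul_ne_zero (ofReal_ne_zero.2 hG2) (Complex.exp_ne_zero _))

lemma laguerreIntegralLeft_exp {β : ℝ} (hβ : 0 < β) (g : ℝ → ℂ) (t : ℝ) :
    laguerreIntegralLeft β g (Real.exp t) = logLeft β (fun s => g (Real.exp s)) t := by
  have hG2 := ofReal_ne_zero.2 (Real.Gamma_pos_of_pos (show 0 < 2 * β by positivity)).ne'
  rw [laguerreIntegralLeft, ← exp_image_Iio, setIntegral_exp_image measurableSet_Iio,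
    setIntegral_congr_fun measurableSet_Iio (fun s hs => cexp_mul_laguerreLeftIntegrand hβ g hs),
    integral_const_mul, setIntegral_eq_integral_of_forall_compl_eq_zero, logLeft]
  · push_cast
    field_simp
  · intro s hs
    simp [logKernel_of_nonpos β (sub_nonpos.2 (not_lt.1 hs))]

lemma laguerreIntegralRight_exp {β : ℝ} (hβ : 0 < β) (f : ℝ → ℂ) (t : ℝ) :
    laguerreIntegralRight β f (Real.exp t) = logRight β (fun s => f (Real.exp s)) t := by
  have hG2 := ofReal_ne_zero.2 (Real.Gamma_pos_of_pos (show 0 < 2 * β by positivity)).ne'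
  rw [laguerreIntegralRight, ← exp_image_Ioi, setIntegral_exp_image measurableSet_Ioi,
    setIntegral_congr_fun measurableSet_Ioi (fun s hs => cexp_mul_laguerreRightIntegrand hβ f hs),
    integral_const_mul, setIntegral_eq_integral_of_forall_compl_eq_zero, logRight]
  · have e1 : cexp (-t) = cexp (t * -β) * cexp ((β - 1) * t) := by
      rw [← Complex.exp_add]; ring_nf
    rw [e1, ← Real.exp_mul]
    push_cast
    field_simp
  · intro s hs
    simp [logKernel_of_nonpos β (sub_nonpos.2 (not_lt.1 hs))]

/-- Since `D = e^{-t} d/dt`, the operator `D x D` is `e^{-t} d²/dt²`. Agreement on the open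
half-axis suffices because derivatives are local. -/
lemma laguerreTheta_eqOn {h W : ℝ → ℂ} (hW : ContDiff ℝ 2 W)
    (hh : EqOn h (fun x => W (Real.log x)) (Ioi 0)) :
    EqOn (laguerreTheta h) (fun x => logTheta W (Real.log x)) (Ioi 0) := by
  have hW1 : ContDiff ℝ 1 (deriv W) := ContDiff.deriv' (by rwa [one_add_one_eq_two])
  have key : ∀ {V k : ℝ → ℂ}, Differentiable ℝ V → EqOn k (fun x => V (Real.log x)) (Ioi 0) →
      ∀ x ∈ Ioi (0 : ℝ), deriv k x = (x : ℂ)⁻¹ * deriv V (Real.log x) := by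
    intro V k hV hk x hx
    have hx : 0 < x := hx
    have h1 : HasDerivAt (fun x => V (Real.log x)) (x⁻¹ • deriv V (Real.log x)) x :=
      (hV (Real.log x)).hasDerivAt.scomp x (Real.hasDerivAt_log hx.ne')
    have h2 := (hk.eventuallyEq_of_mem (Ioi_mem_nhds hx)).deriv_eq
    rw [h2, h1.deriv, real_smul, ofReal_inv]
  intro x hx
  have hx0 : 0 < x := hx
  have hk : EqOn (fun x : ℝ => (x : ℂ) * deriv h x) (fun x => deriv W (Real.log x)) (Ioi 0) := by
    intro y hy
    have hy0 : (y : ℂ) ≠ 0 := ofReal_ne_zero.2 (ne_of_gt hy)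
    simp only
    rw [key (hW.differentiable two_ne_zero) hh y hy, mul_inv_cancel_left₀ hy0]
  rw [laguerreTheta, key (hW1.differentiable one_ne_zero) hk x hx]
  simp only [logTheta]
  rw [Complex.exp_neg, ← ofReal_exp, Real.exp_log hx0]

lemma laguerreTheta_iterate_eqOn {m : ℕ} {h W : ℝ → ℂ}
    (hW : ContDiff ℝ ((2 * m : ℕ) : WithTop ℕ∞) W)
    (hh : EqOn h (fun x => W (Real.log x)) (Ioi 0)) :
    EqOn (laguerreTheta^[m] h) (fun x => logTheta^[m] W (Real.log x)) (Ioi 0) := by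
  induction m with
  | zero => exact hh
  | succ m ih =>
    rw [Function.iterate_succ_apply', Function.iterate_succ_apply']
    refine laguerreTheta_eqOn ?_ (ih (hW.of_le (by norm_cast; lia)))
    exact contDiff_logTheta_iterate (n := 2) (hW.of_le (by norm_cast; lia))

lemma contDiffOn_Ioi_of_eqOn {n : WithTop ℕ∞} {h W : ℝ → ℂ} (hW : ContDiff ℝ n W)
    (hh : EqOn h (fun x => W (Real.log x)) (Ioi 0)) : ContDiffOn ℝ n h (Ioi 0) := by
  refine ContDiffOn.congr ?_ hh
  exact hW.comp_contDiffOn (Real.contDiffOn_log.mono fun x hx => ne_of_gt hx)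

/-- The power `s^a` may vanish on the line (when `σ = 0`), so it controls the weight only for `|y| ≥
1`, where `1 + |y| ≤ 2|s|`. On `[-1, 1]` the continuity of `Φ` suffices. -/
lemma weightedIntegrable_of_cpow_mul {a σ : ℝ} (ha : 0 ≤ a) {Φ : ℝ → ℂ} (hΦ : Continuous Φ)
    (h : Integrable fun y : ℝ => ((σ : ℂ) + y * I) ^ (a : ℂ) * Φ y) :
    WeightedIntegrable a Φ := by
  have hm : Continuous fun τ : ℝ => (((1 + |τ|) ^ a : ℝ) : ℂ) * Φ τ :=
    (continuous_weight a).mul hΦ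
  rw [WeightedIntegrable, ← integrableOn_univ, ← union_compl_self (Icc (-1 : ℝ) 1)]
  refine IntegrableOn.union (hm.continuousOn.integrableOn_compact isCompact_Icc) ?_
  refine Integrable.mono' ((h.norm.const_mul ((2 : ℝ) ^ a)).integrableOn) hm.aestronglyMeasurable ?_
  refine (ae_restrict_iff' measurableSet_Icc.compl).2 (Filter.Eventually.of_forall fun y hy => ?_)
  have hy1 : 1 ≤ |y| := by
    by_contra h'
    exact hy (abs_le.1 (not_le.1 h').le)
  have hs : |y| ≤ ‖(σ : ℂ) + y * I‖ := by
    have := Complex.abs_im_le_norm ((σ : ℂ) + y * I)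
    simpa using this
  rw [norm_mul, norm_mul, norm_real, Real.norm_of_nonneg (by positivity), ← mul_assoc,
    Complex.norm_cpow_real]
  gcongr
  rw [← Real.mul_rpow (by norm_num) (norm_nonneg _)]
  gcongr
  linarith

/-! ### The theorem -/

theorem theorem3 (α ν : ℝ) (m : ℕ) (f g : ℝ → ℂ)
    (hα : 0 < α) (hm : m = laguerreOrder α) (hν : ν < 1 + α - m)
    (hf : MemWeightedL1 (1 - ν - m) f)
    (hg : MemWeightedL1 (ν + m - α) g)
    (hgM : VerticalIntegrable
      (fun s : ℂ => s ^ (2 * (α : ℂ)) * mellin g (s - α)) (ν + m))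
    (hfM : VerticalIntegrable
      (fun s : ℂ => s ^ (2 * (α : ℂ)) * mellin f (s - α)) (1 + α - ν - m))
    (hdom : ν < 1 + α - 2 * m ∨ LaguerreIntegralRightConverges (m - α) f) :
    -- both fractional derivatives are defined in the classical sense
    LaguerreIntegralLeftConverges (m - α) g ∧
    ContDiffOn ℝ ((2 * m : ℕ) : WithTop ℕ∞) (laguerreIntegralLeft (m - α) g) (Ioi 0) ∧
    LaguerreIntegralRightConverges (m - α) f ∧
    ContDiffOn ℝ ((2 * m : ℕ) : WithTop ℕ∞) (laguerreIntegralRight (m - α) f) (Ioi 0) ∧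
    -- both integrals converge absolutely, and they agree
    IntegrableOn (fun x => f x * laguerreDerivLeft α g x) (Ioi 0) ∧
    IntegrableOn (fun x => g x * laguerreDerivRight α f x) (Ioi 0) ∧
    ∫ x in Ioi 0, f x * laguerreDerivLeft α g x =
      ∫ x in Ioi 0, g x * laguerreDerivRight α f x := by
  have hDL : laguerreDerivLeft α g = laguerreTheta^[m] (laguerreIntegralLeft (m - α) g) := by
    rw [laguerreDerivLeft, hm]
  have hDR : laguerreDerivRight α f = laguerreTheta^[m] (laguerreIntegralRight (m - α) f) := by
    rw [laguerreDerivRight, hm]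
  have hmα : α < m ∧ (m : ℝ) ≤ α + 1 := by
    rw [hm, laguerreOrder]
    push_cast
    exact ⟨Nat.lt_floor_add_one α, by linarith [Nat.floor_le hα.le]⟩
  set β : ℝ := m - α with hβdef
  have hβ : 0 < β := by linarith [hmα.1]
  have hβ1 : β ≤ 1 := by linarith [hmα.2]
  have hβm : β ≤ m := by linarith
  set c : ℝ := ν + m - α with hc_def
  set c' : ℝ := 1 - ν - m with hc'_def
  -- The hypothesis `ν < 1 + α - m` says exactly that the line of `g` lies in the strip of the
  -- left-sided kernel.
  have hc : c < 1 := by linarith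
  have hcc : c + c' = 1 + β - m := by linarith
  set F : ℝ → ℂ := fun t => f (Real.exp t) with hF_def
  set G : ℝ → ℂ := fun t => g (Real.exp t) with hG_def
  have hF : ExpIntegrable c' F := (memWeightedL1_iff _ f).1 hf
  have hG : ExpIntegrable c G := (memWeightedL1_iff _ g).1 hg
  have e2α : 2 * (m - β) = 2 * α := by rw [hβdef]; ring
  have hGw : WeightedIntegrable (2 * (m - β)) (lineTransform c G) := by
    rw [e2α]
    refine weightedIntegrable_of_cpow_mul (σ := ν + m) (by positivity) hG.continuous_lineTransform ?_
    refine Integrable.congr hgM (Filter.Eventually.of_forall fun y => ?_)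
    simp only [hG_def, hc_def]
    rw [lineTransform_comp_exp]
    push_cast
    ring_nf
  have hFw : WeightedIntegrable (2 * (m - β)) (lineTransform c' F) := by
    rw [e2α]
    refine weightedIntegrable_of_cpow_mul (σ := 1 + α - ν - m) (by positivity)
      hF.continuous_lineTransform ?_
    refine Integrable.congr hfM (Filter.Eventually.of_forall fun y => ?_)
    simp only [hF_def, hc'_def]
    rw [lineTransform_comp_exp]
    push_cast
    ring_nf
  have hα2 : (0 : ℝ) ≤ 2 * (m - β) := by rw [e2α]; positivity
  have hGi := hGw.integrable hα2
  have hFi := hFw.integrable hα2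
  have hGae := ae_eq_lineInverse_lineTransform hG hGi
  have hFae := ae_eq_lineInverse_lineTransform hF hFi
  -- The continuous representative of `F`. Transforms and kernel integrals do not see the change on
  -- a null set, whereas the regularity argument needs continuity.
  set F₀ := lineInverse c' (lineTransform c' F) with hF₀_def
  have hlogL : logLeft β G = logLeft β (lineInverse c (lineTransform c G)) := by
    funext t
    rw [logLeft, logLeft]
    congr 1
    refine integral_congr_ae ?_
    filter_upwards [hGae] with s hs
    rw [hs]
  have hlogR : logRight β F = logRight β F₀ := by
    funext t
    rw [logRight, logRight]
    congr 1
    refine integral_congr_ae ?_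
    filter_upwards [hFae] with s hs
    rw [hs]
  have hRae : ∀ t : ℝ,
      (fun s : ℝ => (logKernel β (s - t) : ℂ) * (cexp ((β + 1) * s) * F s)) =ᵐ[volume]
        fun s : ℝ => (logKernel β (s - t) : ℂ) * (cexp ((β + 1) * s) * F₀ s) := by
    intro t
    filter_upwards [hFae] with s hs
    rw [hs]
  have hLconv : LaguerreIntegralLeftConverges β g := by
    intro x hx
    rw [← Real.exp_log hx, laguerreLeft_integrableOn_iff hβ]
    refine (integrable_logKernel_mul_lineInverse hβ hβ1 hc hGi (Real.log x)).congr ?_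
    filter_upwards [hGae] with s hs
    rw [← hs]
  have hRconv : LaguerreIntegralRightConverges β f := by
    rcases hdom with h | h
    · intro x hx
      rw [← Real.exp_log hx, laguerreRight_integrableOn_iff hβ]
      -- The condition `β < c'` is precisely `ν < 1 + α - 2m`.
      exact (integrable_logKernel_right hβ hβ1 (by linarith) hFi (Real.log x)).congr
        (hRae (Real.log x)).symm
    · exact h
  have hRi : ∀ t : ℝ, Integrable fun s : ℝ =>
      (logKernel β (s - t) : ℂ) * (cexp ((β + 1) * s) * F₀ s) := fun t =>
    ((laguerreRight_integrableOn_iff hβ f t).1 (hRconv _ (Real.exp_pos t))).congr (hRae t)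
  have hF₀c : Continuous F₀ := continuous_lineInverse _ hFi
  have hF₀ : ExpIntegrable c' F₀ := by
    refine Integrable.congr hF ?_
    filter_upwards [hFae] with s hs
    rw [hs]
  have hT : lineTransform c' F₀ = lineTransform c' F := by
    funext τ
    refine integral_congr_ae ?_
    filter_upwards [hFae] with s hs
    rw [hs]
  obtain ⟨hR1, hR2⟩ := logRight_spec hβ hβ1 hβm hc hcc hF₀c hF₀ (by rw [hT]; exact hFw) hRi
  rw [hT] at hR2
  rw [← hlogR] at hR1 hR2
  have hL1 := contDiff_logLeft_lineInverse hβ hβ1 hc hβm hGw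
  have hL2 := logTheta_iterate_logLeft_lineInverse hβ hβ1 hc hβm hGw
  rw [← hlogL] at hL1 hL2
  have hLeq : EqOn (laguerreIntegralLeft β g) (fun x => logLeft β G (Real.log x)) (Ioi 0) := by
    intro x hx
    simp only
    rw [← laguerreIntegralLeft_exp hβ, Real.exp_log hx]
  have hReq : EqOn (laguerreIntegralRight β f) (fun x => logRight β F (Real.log x)) (Ioi 0) := by
    intro x hx
    simp only
    rw [← laguerreIntegralRight_exp hβ, Real.exp_log hx]
  -- The relation `c + c' = 1 + β - m` puts `𝒟_{0+}^α g` on the line `Re s = 1 - c'` dual to that of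
  -- `f`, and likewise `𝒟_-^α f` on `Re s = 1 - c`, as Parseval's identity requires.
  have hDLexp : ∀ t, laguerreDerivLeft α g (Real.exp t) = lineInverse (1 - c')
      (fun τ => laguerreMultiplier β m c τ * lineTransform c G τ) t := by
    intro t
    rw [hDL, laguerreTheta_iterate_eqOn hL1 hLeq (Real.exp_pos t)]
    simp only
    rw [Real.log_exp, hL2, show c - β + m = 1 - c' by linarith]
  have hDRexp : ∀ t, laguerreDerivRight α f (Real.exp t) = lineInverse (1 - c)
      (fun τ => laguerreMultiplier β m c (-τ) * lineTransform c' F τ) t := by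
    intro t
    rw [hDR, laguerreTheta_iterate_eqOn hR1 hReq (Real.exp_pos t)]
    simp only
    rw [Real.log_exp, hR2, show c' - β + m = 1 - c by linarith]
  have hGM := hGw.integrable_laguerreMultiplier_mul hβ hβ1 hc
  have hFM := hFw.integrable_laguerreMultiplier_neg_mul hβ hβ1 hc
  refine ⟨hLconv, contDiffOn_Ioi_of_eqOn hL1 hLeq, hRconv, contDiffOn_Ioi_of_eqOn hR1 hReq,
    ?_, ?_, ?_⟩
  · rw [integrableOn_Ioi_zero_iff]
    simp only [hDLexp, ← mul_assoc]
    exact integrable_exp_mul_lineInverse hF hGM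
  · rw [integrableOn_Ioi_zero_iff]
    simp only [hDRexp, ← mul_assoc]
    exact integrable_exp_mul_lineInverse hG hFM
  · rw [setIntegral_Ioi_zero, setIntegral_Ioi_zero]
    simp only [hDLexp, hDRexp, ← mul_assoc]
    have := integral_laguerreMultiplier_adjoint hcc hF hG hFM hGM
    rwa [show c - β + m = 1 - c' by linarith, show c' - β + m = 1 - c by linarith] at this
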